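/- **Model.** Base stations (BSs) form a homogeneous Poisson point process $\Phi$ of density $\lambda>0$ on the plane; the typical user (UE) is at the origin. A BS at 2D distance $r$ has 3D distance $w=\sqrt{r^2+L^2}$ from the UE, where $L\ge 0$ is the antenna height difference. Let $N\ge1$ and $L=d_0<d_1<\dots<d_{N-1}<d_N=+\infty$. The path loss functions are $$\zeta^{\rm Path}(w)=\zeta_n^{\rm Path}(w)=A_n^{\rm Path}w^{-\alpha_n^{\rm Path}},\qquad {\rm Pr}^{\rm L}(w)={\rm Pr}^{\rm L}_n(w)\qquad\text{for } d_{n-1}<w\le d_n$$ (for $n=1$ also at $w=L$), ${\rm Path}\in\{{\rm L},{\rm NL}\}$, with $A_n^{\rm Path}>0$, with $\zeta^{\rm L}$ and $\zeta^{\rm NL}$ continuous and strictly decreasing on $\{w\ge L,\ w>0\}$, and with each ${\rm Pr}^{\rm L}_n$ nonincreasing and $[0,1]$-valued on its piece. Given $\Phi$, independently for each BS, its path to the UE is LoS (L) with probability ${\rm Pr}^{\rm L}(w)$ and otherwise NLoS (NL), and, given this, its channel gain has a law $F^{\rm L}$, respectively $F^{\rm NL}$, on $[0,\infty)$ (for Rayleigh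 fading both are the exponential law with mean $1$). Let $\beta_i=\zeta^{\rm L}(w_i)$ or $\zeta^{\rm NL}(w_i)$, according to the path of the BS $b_i$, and $g_i$ its gain. The UE is served by the BS $b_o$ with the largest $\beta_i$ (the smallest path loss); let $R$ be the 2D distance of $b_o$ and $h$ its gain. With transmission power $P>0$ and noise power $P_{\rm N}\ge0$ put $I_{\rm agg}=\sum_{b_i\in\Phi\setminus b_o}P\beta_ig_i\in[0,\infty]$, let $\mathrm{SINR}=P\beta_oh/(I_{\rm agg}+P_{\rm N})$, and for $\gamma>0$ let $p^{\rm cov}(\lambda,\gamma)=\Pr[\mathrm{SINR}>\gamma]$. **Theorem.** The coverage probability is $$p^{\rm cov}(\lambda,\gamma)=\sum_{n=1}^N\left(T_n^{\rm L}+T_n^{\rm NL}\right),\qquad T_n^{\rm Path}=\int_{\sqrt{d_{n-1}^2-L^2}}^{\sqrt{d_n^2-L^2}}\Pr\left[\frac{P\zeta_n^{\rm Path}\left(\sqrt{r^2+L^2}\right)h}{I_{\rm agg}+P_{\rm N}}>\gamma\right]f_{R,n}^{\rm Path}(r)\,dr,$$ where $\Pr[\cdot]$ in $T_n^{\rm Path}$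 is the conditional probability given that the serving BS has a path of type Path and 2D distance $R=r$, and where, for $\sqrt{d_{n-1}^2-L^2}<r\le\sqrt{d_n^2-L^2}$, $$f_{R,n}^{\rm L}(r)=\exp\left(-\int_0^{r_1}\left(1-{\rm Pr}^{\rm L}(\sqrt{u^2+L^2})\right)2\pi u\lambda\,du\right)\exp\left(-\int_0^{r}{\rm Pr}^{\rm L}(\sqrt{u^2+L^2})2\pi u\lambda\,du\right){\rm Pr}_n^{\rm L}(\sqrt{r^2+L^2})\,2\pi r\lambda,$$ $$f_{R,n}^{\rm NL}(r)=\exp\left(-\int_0^{r_2}{\rm Pr}^{\rm L}(\sqrt{u^2+L^2})2\pi u\lambda\,du\right)\exp\left(-\int_0^{r}\left(1-{\rm Pr}^{\rm L}(\sqrt{u^2+L^2})\right)2\pi u\lambda\,du\right)\left(1-{\rm Pr}_n^{\rm L}(\sqrt{r^2+L^2})\right)2\pi r\lambda.$$ Here $r_1\ge0$ is the solution of $\zeta^{\rm NL}(\sqrt{r_1^2+L^2})=\zeta_n^{\rm L}(\sqrt{r^2+L^2})$ and $r_2\ge0$ the solution of $\zeta^{\rm L}(\sqrt{r_2^2+L^2})=\zeta_n^{\rm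 NL}(\sqrt{r^2+L^2})$; a radius whose equation has no solution is $0$. Moreover $f_{R,n}^{\rm Path}$ is the density of the serving distance: for every Borel set $B\subseteq\left(\sqrt{d_{n-1}^2-L^2},\sqrt{d_n^2-L^2}\right]$ (for $n=N$: $B\subseteq\left(\sqrt{d_{N-1}^2-L^2},\infty\right)$), the probability that the serving BS has a path of type Path and $R\in B$ equals $\int_Bf_{R,n}^{\rm Path}(r)\,dr$. -/

import Mathlib

open MeasureTheory ProbabilityTheory Set
open scoped ENNReal NNReal

/-- The two kinds of transmission path. -/
inductive PathKind where
  | los : PathKind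
  | nlos : PathKind

/-- The other kind of path. -/
def PathKind.other : PathKind → PathKind
  | .los => .nlos
  | .nlos => .los

instance : MeasurableSpace PathKind := ⊤

/-- The data of the `N`-piece LoS/NLoS path loss model. Pieces are numbered `1, …, N`; values of the
functions at other indices are irrelevant. -/
structure PathLossModel where
  /-- number of pieces -/
  N : ℕ
  /-- absolute antenna height difference -/
  L : ℝ
  /-- break points `d 0 = L < d 1 < ⋯ < d (N-1)`; the convention `d N = +∞` is built into
  `piece` and `radialPiece` below -/
  d : ℕ → ℝ
  /-- path losses at the reference distance 1 -/
  A : PathKind → ℕ → ℝ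
  /-- path loss exponents -/
  α : PathKind → ℕ → ℝ
  /-- `prL n w` is the LoS probability at 3D distance `w`, for `w` in the `n`-th piece -/
  prL : ℕ → ℝ → ℝ

namespace PathLossModel

variable (M : PathLossModel)

/-- The 3D distance that corresponds to the 2D distance `r`. -/
noncomputable def dist3 (r : ℝ) : ℝ := √(r ^ 2 + M.L ^ 2)

/-- The 3D distances of the `n`-th piece: `L ≤ w ≤ d 1`, `d (n-1) < w ≤ d n`, `w > d (N-1)`. -/
def piece (n : ℕ) : Set ℝ :=
  {w | (if n = 1 then M.L ≤ w else M.d (n - 1) < w) ∧ (n = M.N ∨ w ≤ M.d n)}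

/-- The 2D distances `√(d (n-1)² - L²) < r ≤ √(d n² - L²)`, with `d N = +∞`. -/
noncomputable def radialPiece (n : ℕ) : Set ℝ :=
  if n = M.N then Ioi √(M.d (n - 1) ^ 2 - M.L ^ 2)
  else Ioc √(M.d (n - 1) ^ 2 - M.L ^ 2) √(M.d n ^ 2 - M.L ^ 2)

/-- The `n`-th piece path loss function `A w ^ (-α)` of a LoS or NLoS path. -/
noncomputable def lossPiece (p : PathKind) (n : ℕ) (w : ℝ) : ℝ := M.A p n * w ^ (-M.α p n)

/-- The piece-wise path loss function of a LoS or NLoS path. -/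
noncomputable def loss (p : PathKind) (w : ℝ) : ℝ :=
  ∑ n ∈ Finset.Icc 1 M.N, (M.piece n).indicator (M.lossPiece p n) w

/-- `n`-th piece probability of a path of the given kind. -/
def probPiece : PathKind → ℕ → ℝ → ℝ
  | .los, n, w => M.prL n w
  | .nlos, n, w => 1 - M.prL n w

/-- The piece-wise probability function of a path of the given kind. -/
noncomputable def prob (p : PathKind) (w : ℝ) : ℝ :=
  ∑ n ∈ Finset.Icc 1 M.N, (M.piece n).indicator (M.probPiece p n) w

/-- The standing assumptions on the path loss model. -/
structure Valid : Prop where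
  one_le_N : 1 ≤ M.N
  L_nonneg : 0 ≤ M.L
  d_zero : M.d 0 = M.L
  d_lt : ∀ n, n + 1 < M.N → M.d n < M.d (n + 1)
  A_pos : ∀ p, ∀ n ∈ Finset.Icc 1 M.N, 0 < M.A p n
  loss_continuousOn : ∀ p, ContinuousOn (M.loss p) {w | M.L ≤ w ∧ 0 < w}
  loss_strictAntiOn : ∀ p, StrictAntiOn (M.loss p) {w | M.L ≤ w ∧ 0 < w}
  prL_mem : ∀ n ∈ Finset.Icc 1 M.N, ∀ w ∈ M.piece n, M.prL n w ∈ Icc (0 : ℝ) 1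
  prL_antitoneOn : ∀ n ∈ Finset.Icc 1 M.N, AntitoneOn (M.prL n) (M.piece n)

open Classical in
/-- The equal-path-loss radius: the `u ≥ 0` at which a path of the other kind has the same path loss
as an `n`-th piece path of kind `p` at 2D distance `r`. If there is none (then every path of the
other kind is worse than the given one, wherever its transmitter is), it is `0`.
It is `r₁` for `p = los` and `r₂` for `p = nlos`. -/
noncomputable def equalLossRadius (p : PathKind) (n : ℕ) (r : ℝ) : ℝ :=
  if h : ∃ u, 0 ≤ u ∧ M.loss p.other (M.dist3 u) = M.lossPiece p n (M.dist3 r) then h.choose else 0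

/-- The geometrical density function `f_{R,n}` for a serving path of kind `p`, at BS density `lam`. -/
noncomputable def servingDensity (lam : ℝ) (p : PathKind) (n : ℕ) (r : ℝ) : ℝ :=
  Real.exp (-∫ u in (0 : ℝ)..M.equalLossRadius p n r,
      M.prob p.other (M.dist3 u) * (2 * Real.pi * u * lam)) *
    Real.exp (-∫ u in (0 : ℝ)..r, M.prob p (M.dist3 u) * (2 * Real.pi * u * lam)) *
    M.probPiece p n (M.dist3 r) * (2 * Real.pi * r * lam)

end PathLossModel

/-- The plane. -/
abbrev Plane : Type := EuclideanSpace ℝ (Fin 2)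

/-- The random points `X 0, X 1, …` enumerate a homogeneous Poisson point pattern of density `lam`
on the plane: the number of points in a set of finite area is Poisson distributed with mean
`lam * area`, and the numbers in disjoint sets are independent. -/
structure IsHomogeneousPoisson {Ω : Type*} [MeasurableSpace Ω] (μ : Measure Ω) (lam : ℝ)
    (X : ℕ → Ω → Plane) : Prop where
  measurable : ∀ i, Measurable (X i)
  count_law : ∀ B : Set Plane, MeasurableSet B → volume B ≠ ∞ → ∀ k : ℕ,
    μ {ω | {i | X i ω ∈ B}.encard = k} =
      poissonMeasure (lam.toNNReal * (volume B).toNNReal) {k}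
  count_indep : ∀ (m : ℕ) (B : Fin m → Set Plane), (∀ j, MeasurableSet (B j)) →
    (∀ j, volume (B j) ≠ ∞) → Pairwise (fun j k => Disjoint (B j) (B k)) →
    iIndepFun (fun j ω => {i | X i ω ∈ B j}.encard) μ

/-- The random data of the network, as seen from the typical UE at the origin: positions of the BSs,
kinds of their paths to the UE, and multi-path fading channel gains. -/
structure Network (Ω : Type*) where
  X : ℕ → Ω → Plane
  path : ℕ → Ω → PathKind
  gain : ℕ → Ω → ℝ

namespace Network

variable {Ω : Type*} [MeasurableSpace Ω] (S : Network Ω) (M : PathLossModel)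

/-- The law of the network: the BSs form a homogeneous Poisson pattern of density `lam`; given the
positions, the pairs (path, channel gain) are independent over the BSs, a path is of kind `p` with
probability `M.prob p w` at 3D distance `w`, and given that, the gain has law `fading p`
(Rayleigh fading is `fading p = expMeasure 1` for both `p`). -/
structure IsModel (μ : Measure Ω) (lam : ℝ) (fading : PathKind → Measure ℝ) : Prop where
  poisson : IsHomogeneousPoisson μ lam S.X
  path_measurable : ∀ i, Measurable (S.path i)
  gain_measurable : ∀ i, Measurable (S.gain i)
  marks : ∀ (C : Set (ℕ → Plane)) (I : Finset ℕ) (p : ℕ → PathKind) (B : ℕ → Set ℝ),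
    MeasurableSet C → (∀ i, MeasurableSet (B i)) →
    μ {ω | (fun i => S.X i ω) ∈ C ∧ ∀ i ∈ I, S.path i ω = p i ∧ S.gain i ω ∈ B i} =
      ∫⁻ ω in {ω | (fun i => S.X i ω) ∈ C},
        ∏ i ∈ I, ENNReal.ofReal (M.prob (p i) (M.dist3 ‖S.X i ω‖)) * fading (p i) (B i) ∂μ

/-- The path loss `β i` of the `i`-th BS. -/
noncomputable def beta (i : ℕ) (ω : Ω) : ℝ := M.loss (S.path i ω) (M.dist3 ‖S.X i ω‖)

open Classical in
/-- The index of the serving BS, the one with the largest `β`. Ties are broken by the smallest index,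
and the index is `0` if there is no maximum. -/
noncomputable def serving (ω : Ω) : ℕ :=
  if h : ∃ i, ∀ j, S.beta M j ω ≤ S.beta M i ω then Nat.find h else 0

/-- Kind of the path to the serving BS. -/
noncomputable def servingPath (ω : Ω) : PathKind := S.path (S.serving M ω) ω

/-- 2D distance to the serving BS. -/
noncomputable def servingDist (ω : Ω) : ℝ := ‖S.X (S.serving M ω) ω‖

/-- Channel gain `h` of the serving BS. -/
noncomputable def servingGain (ω : Ω) : ℝ := S.gain (S.serving M ω) ω

open Classical in
/-- Aggregate interference, for the transmission power `P`. It may be infinite. -/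
noncomputable def interference (P : ℝ) (ω : Ω) : ℝ≥0∞ :=
  ∑' i, if i = S.serving M ω then 0 else ENNReal.ofReal (P * S.beta M i ω * S.gain i ω)

/-- Signal-to-interference-plus-noise ratio, for the noise power `PN`. -/
noncomputable def sinr (P PN : ℝ) (ω : Ω) : ℝ≥0∞ :=
  ENNReal.ofReal (P * S.beta M (S.serving M ω) ω * S.servingGain M ω) /
    (S.interference M P ω + ENNReal.ofReal PN)

/-- The coverage probability. -/
noncomputable def coverage (μ : Measure Ω) (P PN γ : ℝ) : ℝ :=
  μ.real {ω | ENNReal.ofReal γ < S.sinr M P PN ω}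

/-- The conditional probability that `P ζ_n(√(r² + L²)) h / (I_agg + PN) > γ`, given that the UE is
served by a BS with a path of kind `p` at 2D distance `r`. -/
noncomputable def condCoverage (μ : Measure Ω) [IsFiniteMeasure μ] (P PN γ : ℝ)
    (p : PathKind) (n : ℕ) (r : ℝ) : ℝ :=
  (condDistrib (fun ω => (S.servingGain M ω, S.interference M P ω))
      (fun ω => (S.servingPath M ω, S.servingDist M ω)) μ (p, r)).real
    {x | ENNReal.ofReal γ <
      ENNReal.ofReal (P * M.lossPiece p n (M.dist3 r) * x.1) / (x.2 + ENNReal.ofReal PN)}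

/-- The component of the coverage probability due to `n`-th piece paths of kind `p`. -/
noncomputable def coverageTerm (μ : Measure Ω) [IsFiniteMeasure μ] (lam P PN γ : ℝ)
    (p : PathKind) (n : ℕ) : ℝ :=
  ∫ r in M.radialPiece n, S.condCoverage M μ P PN γ p n r * M.servingDensity lam p n r

end Network

/-! Let Λ_p(s) (`meanCount`) be the mean number of BSs with a path of kind p within 2D distance s.
The void probability of the marked pattern is explicit: for both kinds q simultaneously, no BS of
kind q lies within s_q with probability exp(-Λ_L(s_L) - Λ_NL(s_NL)) (`measure_forall_le_norm`). It
follows from the generating functional E ∏ (1 - g(X_i)) = exp(-λ ∫ g) of the Poisson pattern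
(`lintegral_voidProd`), with g(x) the probability that a BS at x gets a kind for which x is too
near.

Since the exponent is a sum over the kinds, the distances to the nearest BS of each kind are
independent, with tails exp(-Λ_p). Differentiating a tail gives the density exp(-Λ_p(r)) Λ_p'(r),
and the joint law can be integrated over one of the distances (`measure_nearest_mem`).

Within one kind the loss function decreases strictly with distance, so the serving BS is the nearest
of its kind. Up to null ties, kind p wins at distance r exactly when the nearest BS of the other
kind lies beyond the equal-loss radius ρ(r) (`loss_other_lt_iff`). By independence this multiplies
the nearest-distance density by exp(-Λ_other(ρ(r))); the product is `servingDensity`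
(`measure_servingPath_servingDist`).

The coverage event is finally split by serving kind and piece, and each part is disintegrated over
(kind, distance) by the regular conditional distribution (`measureReal_coverage_inter`). The law of
the interference is never computed; only its measurability enters. -/

/-! ### Counts and generating functional of the Poisson pattern. -/

lemma ENNReal.iInf_prod_range_eq_prod {f : ℕ → ℝ≥0∞} (hf : ∀ i, f i ≤ 1) (F : Finset ℕ)
    (hF : ∀ i, i ∉ F → f i = 1) :
    ⨅ n, ∏ i ∈ Finset.range n, f i = ∏ i ∈ F, f i := by
  apply le_antisymm
  · obtain ⟨n, hn⟩ : ∃ n, F ⊆ Finset.range n := F.exists_nat_subset_range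
    refine (iInf_le _ n).trans (le_of_eq ?_)
    exact (Finset.prod_subset hn fun i _ hi => hF i hi).symm
  · refine le_iInf fun n => ?_
    calc ∏ i ∈ F, f i ≤ ∏ i ∈ F ∩ Finset.range n, f i :=
          Finset.prod_le_prod_of_subset_of_le_one' Finset.inter_subset_left fun i _ _ => hf i
      _ = ∏ i ∈ Finset.range n, f i :=
          Finset.prod_subset Finset.inter_subset_right fun i hi hi' =>
            hF i fun h => hi' (Finset.mem_inter.2 ⟨h, hi⟩)

/-- Having at least k points in `B` is a countable union, over k-element index sets, of finite
intersections of measurable events. -/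
lemma measurable_encard_setOf_mem {Ω E : Type*} [MeasurableSpace Ω] [MeasurableSpace E]
    {X : ℕ → Ω → E} (hX : ∀ i, Measurable (X i)) {B : Set E} (hB : MeasurableSet B) :
    Measurable fun ω => {i | X i ω ∈ B}.encard := by
  have hle : ∀ k : ℕ, MeasurableSet {ω | (k : ℕ∞) ≤ {i | X i ω ∈ B}.encard} := by
    intro k
    have : {ω | (k : ℕ∞) ≤ {i | X i ω ∈ B}.encard} =
        ⋃ t : Finset ℕ, ⋃ _ : t.card = k, ⋂ i ∈ t, X i ⁻¹' B := by
      ext ω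
      simp only [mem_ofPred_eq, mem_iUnion, mem_iInter, mem_preimage, exists_prop]
      constructor
      · intro h
        obtain ⟨t, hts, ht⟩ := Set.exists_subset_encard_eq h
        have htf : t.Finite := Set.finite_of_encard_eq_coe ht
        refine ⟨htf.toFinset, ?_, fun i hi => hts (htf.mem_toFinset.1 hi)⟩
        rw [htf.encard_eq_coe_toFinset_card] at ht
        exact_mod_cast ht
      · rintro ⟨t, rfl, ht⟩
        rw [← Set.encard_coe_eq_coe_finsetCard]
        exact Set.encard_le_encard fun i hi => ht i hi
    rw [this]
    exact MeasurableSet.iUnion fun t => MeasurableSet.iUnion fun _ =>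
      Finset.measurableSet_biInter _ fun i _ => hX i hB
  refine measurable_to_countable' fun k => ?_
  induction k with
  | top =>
    have : (fun ω => {i | X i ω ∈ B}.encard) ⁻¹' {⊤} =
        ⋂ k : ℕ, {ω | (k : ℕ∞) ≤ {i | X i ω ∈ B}.encard} := by
      ext ω
      simp only [mem_preimage, mem_singleton_iff, mem_iInter, mem_ofPred_eq]
      exact ENat.eq_top_iff_forall_ge
    rw [this]
    exact MeasurableSet.iInter hle
  | coe k =>
    have : (fun ω => {i | X i ω ∈ B}.encard) ⁻¹' {(k : ℕ∞)} =
        {ω | (k : ℕ∞) ≤ {i | X i ω ∈ B}.encard} \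
          {ω | ((k + 1 : ℕ) : ℕ∞) ≤ {i | X i ω ∈ B}.encard} := by
      ext ω
      simp only [mem_preimage, mem_singleton_iff, mem_sdiff, mem_ofPred_eq, Nat.cast_add,
        Nat.cast_one, ENat.add_one_le_iff (ENat.natCast_ne_top k), not_lt]
      exact ⟨fun h => ⟨h.ge, h.le⟩, fun h => le_antisymm h.2 h.1⟩
    rw [this]
    exact (hle k).diff (hle (k + 1))

lemma lintegral_pow_poissonMeasure (r : ℝ≥0) {c : ℝ≥0∞} (hc : c ≤ 1) :
    ∫⁻ k, c ^ k ∂poissonMeasure r = ENNReal.ofReal (Real.exp (-(r * (1 - c.toReal)))) := by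
  have hc' : c = ENNReal.ofReal c.toReal :=
    (ENNReal.ofReal_toReal (hc.trans_lt ENNReal.one_lt_top).ne).symm
  rw [lintegral_countable']
  have h0 : ∀ k : ℕ, 0 ≤ Real.exp (-r) * (((r : ℝ) * c.toReal) ^ k / (k.factorial : ℝ)) :=
    fun k => by positivity
  have hs := ((NormedSpace.expSeries_div_hasSum_exp ((r : ℝ) * c.toReal)).mul_left
    (Real.exp (-r)))
  have : ∀ k : ℕ, c ^ k * poissonMeasure r {k} =
      ENNReal.ofReal (Real.exp (-r) * (((r : ℝ) * c.toReal) ^ k / (k.factorial : ℝ))) := by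
    intro k
    rw [poissonMeasure_singleton]
    conv_lhs => rw [hc', ← ENNReal.ofReal_pow ENNReal.toReal_nonneg,
      ← ENNReal.ofReal_mul (by positivity)]
    congr 1
    rw [mul_pow]
    ring
  simp_rw [this]
  rw [← ENNReal.ofReal_tsum_of_nonneg h0 hs.summable, hs.tsum_eq, ← Real.exp_eq_exp_ℝ,
    ← Real.exp_add]
  congr 2
  ring

namespace IsHomogeneousPoisson

variable {Ω : Type*} [MeasurableSpace Ω] {μ : Measure Ω} [IsProbabilityMeasure μ] {lam : ℝ}
  {X : ℕ → Ω → Plane}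

/-- `count_law` speaks of finite counts only. An infinite count gets mass 0 because both sides are
probability measures that agree on every finite value. -/
lemma map_encard (h : IsHomogeneousPoisson μ lam X) {B : Set Plane} (hB : MeasurableSet B)
    (hB' : volume B ≠ ∞) :
    μ.map (fun ω => {i | X i ω ∈ B}.encard) =
      (poissonMeasure (lam.toNNReal * (volume B).toNNReal)).map (Nat.cast : ℕ → ℕ∞) := by
  have hm := measurable_encard_setOf_mem h.measurable hB
  have hcast : Measurable (Nat.cast : ℕ → ℕ∞) := measurable_from_top
  have : IsProbabilityMeasure (μ.map (fun ω => {i | X i ω ∈ B}.encard)) :=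
    Measure.isProbabilityMeasure_map hm.aemeasurable
  have : IsProbabilityMeasure ((poissonMeasure (lam.toNNReal * (volume B).toNNReal)).map
    (Nat.cast : ℕ → ℕ∞)) := Measure.isProbabilityMeasure_map hcast.aemeasurable
  have key : ∀ k : ℕ, μ.map (fun ω => {i | X i ω ∈ B}.encard) {(k : ℕ∞)} =
      (poissonMeasure (lam.toNNReal * (volume B).toNNReal)).map (Nat.cast : ℕ → ℕ∞) {(k : ℕ∞)} := by
    intro k
    rw [Measure.map_apply hm (measurableSet_singleton _),
      Measure.map_apply hcast (measurableSet_singleton _)]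
    have : (Nat.cast : ℕ → ℕ∞) ⁻¹' {(k : ℕ∞)} = {k} := by ext; simp
    rw [this, ← h.count_law B hB hB' k]
    rfl
  have htop : ({⊤} : Set ℕ∞) = (⋃ k : ℕ, {(k : ℕ∞)})ᶜ := by
    ext x
    induction x with
    | top => simp
    | coe k => simp
  refine Measure.ext_of_singleton fun x => ?_
  induction x with
  | top =>
    rw [htop, prob_compl_eq_one_sub (Set.to_countable _).measurableSet,
      prob_compl_eq_one_sub (Set.to_countable _).measurableSet]
    congr 1
    have hd : Pairwise (Function.onFun Disjoint fun k : ℕ => ({(k : ℕ∞)} : Set ℕ∞)) := by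
      intro i j hij
      simpa [Function.onFun] using hij
    rw [measure_iUnion hd fun _ => measurableSet_singleton _,
      measure_iUnion hd fun _ => measurableSet_singleton _]
    exact tsum_congr key
  | coe k => exact key k

lemma ae_finite (h : IsHomogeneousPoisson μ lam X) {B : Set Plane} (hB : MeasurableSet B)
    (hB' : volume B ≠ ∞) : ∀ᵐ ω ∂μ, {i | X i ω ∈ B}.Finite := by
  have hm := measurable_encard_setOf_mem h.measurable hB
  have : ∀ᵐ k ∂(μ.map (fun ω => {i | X i ω ∈ B}.encard)), k ≠ ⊤ := by
    rw [h.map_encard hB hB']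
    exact (ae_map_iff (measurable_from_top).aemeasurable (MeasurableSet.of_discrete)).2
      (Filter.Eventually.of_forall fun k => ENat.natCast_ne_top k)
  filter_upwards [ae_of_ae_map hm.aemeasurable this] with ω hω
  exact Set.encard_ne_top_iff.1 hω

lemma ae_ne_zero (h : IsHomogeneousPoisson μ lam X) : ∀ᵐ ω ∂μ, ∀ i, X i ω ≠ 0 := by
  -- The origin has area 0, so its count is Poisson with mean 0.
  have h0 := h.count_law {0} (measurableSet_singleton _) (by simp) 0
  have hm := measurable_encard_setOf_mem h.measurable (measurableSet_singleton (0 : Plane))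
  have : ∀ᵐ ω ∂μ, {i | X i ω ∈ ({0} : Set Plane)}.encard = (0 : ℕ) := by
    refine (mem_ae_iff_prob_eq_one (hm (measurableSet_singleton _))).2 (h0.trans ?_)
    simp [poissonMeasure_singleton]
  filter_upwards [this] with ω hω i hi
  simp only [Nat.cast_zero, Set.encard_eq_zero] at hω
  exact (Set.eq_empty_iff_forall_notMem.1 hω i) hi

lemma lintegral_pow_encard (h : IsHomogeneousPoisson μ lam X) {B : Set Plane}
    (hB : MeasurableSet B) (hB' : volume B ≠ ∞) {c : ℝ≥0∞} (hc : c ≤ 1) :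
    ∫⁻ ω, c ^ {i | X i ω ∈ B}.encard.toNat ∂μ =
      ENNReal.ofReal (Real.exp (-(lam.toNNReal * (volume B).toNNReal * (1 - c.toReal)))) := by
  have hm := measurable_encard_setOf_mem h.measurable hB
  have hφ : Measurable fun k : ℕ∞ => c ^ k.toNat := measurable_from_top
  rw [← lintegral_map hφ hm, h.map_encard hB hB', lintegral_map hφ measurable_from_top]
  simp only [ENat.toNat_natCast]
  rw [lintegral_pow_poissonMeasure _ hc]
  simp

end IsHomogeneousPoisson

/-- The generating functional of the points `x` at `1 - g`, as a limit of finite products. -/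
noncomputable def voidProd {E : Type*} (g : E → ℝ≥0∞) (x : ℕ → E) : ℝ≥0∞ :=
  ⨅ n, ∏ i ∈ Finset.range n, (1 - g (x i))

lemma measurable_voidProd {Ω E : Type*} [MeasurableSpace Ω] [MeasurableSpace E]
    {X : ℕ → Ω → E} (hX : ∀ i, Measurable (X i)) {g : E → ℝ≥0∞} (hg : Measurable g) :
    Measurable fun ω => voidProd g fun i => X i ω :=
  Measurable.iInf fun _ => Finset.measurable_fun_prod _ fun i _ =>
    measurable_const.sub (hg.comp (hX i))

/-- Grouping indices by the value of `g` leaves only counts in level sets, whose joint law is given.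
The value 0 contributes factors 1 and is dropped, since its level set may contain infinitely many
points. -/
lemma voidProd_simpleFunc {E : Type*} [MeasurableSpace E] (g : SimpleFunc E ℝ≥0∞) (x : ℕ → E)
    (hx : {i | g (x i) ≠ 0}.Finite) :
    voidProd g x = ∏ c ∈ g.range.erase 0, (1 - c) ^ {i | x i ∈ g ⁻¹' {c}}.encard.toNat := by
  classical
  rw [voidProd, ENNReal.iInf_prod_range_eq_prod (fun _ => tsub_le_self) hx.toFinset
    (fun i hi => by simp at hi; simp [hi])]
  rw [← Finset.prod_fiberwise_of_maps_to (s := hx.toFinset) (t := g.range.erase 0)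
    (g := fun i => g (x i)) (fun i hi => by
      simp only [Finite.mem_toFinset, mem_ofPred_eq] at hi
      exact Finset.mem_erase.2 ⟨hi, SimpleFunc.mem_range_self _ _⟩)]
  refine Finset.prod_congr rfl fun c hc => ?_
  rw [Finset.prod_congr rfl (g := fun _ => 1 - c)
    (fun i hi => by rw [(Finset.mem_filter.1 hi).2]), Finset.prod_const]
  congr 1
  have : {i | x i ∈ g ⁻¹' {c}} = ↑(hx.toFinset.filter fun i => g (x i) = c) := by
    ext i
    have := (Finset.mem_erase.1 hc).1
    simp only [mem_preimage, mem_singleton_iff, mem_ofPred_eq, Finset.coe_filter,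
      Finite.mem_toFinset]
    exact ⟨fun h => ⟨h ▸ this, h⟩, fun h => h.2⟩
  rw [this, Set.encard_coe_eq_coe_finsetCard, ENat.toNat_natCast]

namespace IsHomogeneousPoisson

variable {Ω : Type*} [MeasurableSpace Ω] {μ : Measure Ω} [IsProbabilityMeasure μ] {lam : ℝ}
  {X : ℕ → Ω → Plane}

/-- The nonzero level sets are disjoint and of finite area, so their counts are independent. The
expectation is a product of Poisson generating functions at 1 - c, and the exponents λ c vol(g = c)
add up to λ ∫ g. -/
lemma lintegral_voidProd_simpleFunc (h : IsHomogeneousPoisson μ lam X) (hlam : 0 ≤ lam)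
    (g : SimpleFunc Plane ℝ≥0∞)
    (hg1 : ∀ x, g x ≤ 1) {D : Set Plane} (hD : MeasurableSet D) (hD' : volume D ≠ ∞)
    (hgD : ∀ x, x ∉ D → g x = 0) :
    ∫⁻ ω, voidProd g (fun i => X i ω) ∂μ =
      ENNReal.ofReal (Real.exp (-(lam * (∫⁻ x, g x).toReal))) := by
  have hsub : ∀ c, c ≠ 0 → g ⁻¹' {c} ⊆ D := fun c hc x hx => by
    by_contra hxD
    exact hc ((hgD x hxD).symm.trans hx).symm
  have hfin : ∀ c ∈ g.range.erase 0, volume (g ⁻¹' {c}) ≠ ∞ := fun c hc =>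
    measure_ne_top_of_subset (hsub c (Finset.mem_erase.1 hc).1) hD'
  have hc1 : ∀ c ∈ g.range.erase 0, c ≤ 1 := fun c hc => by
    obtain ⟨x, rfl⟩ := SimpleFunc.mem_range.1 (Finset.mem_erase.1 hc).2
    exact hg1 x
  have hae : ∀ᵐ ω ∂μ, voidProd g (fun i => X i ω) =
      ∏ c ∈ g.range.erase 0, (1 - c) ^ {i | X i ω ∈ g ⁻¹' {c}}.encard.toNat := by
    filter_upwards [h.ae_finite hD hD'] with ω hω
    exact voidProd_simpleFunc g _ (hω.subset fun i hi => by
      by_contra hiD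
      exact hi (hgD _ hiD))
  rw [lintegral_congr_ae hae]
  let e := (g.range.erase 0).equivFin
  have hreindex : ∀ f : ℝ≥0∞ → ℝ≥0∞, ∏ c ∈ g.range.erase 0, f c = ∏ j, f (e.symm j) := by
    intro f
    rw [← Finset.prod_coe_sort]
    exact (Equiv.prod_comp e.symm (fun c : ↥(g.range.erase 0) => f c)).symm
  have hind := h.count_indep _ (fun j => g ⁻¹' {((e.symm j : ↥(g.range.erase 0)) : ℝ≥0∞)})
    (fun j => g.measurableSet_fiber _) (fun j => hfin _ (e.symm j).2)
    (fun j k hjk => by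
      refine Disjoint.preimage _ (Set.disjoint_singleton.2 fun h => hjk ?_)
      exact e.symm.injective (Subtype.ext h))
  have hind' := hind.comp (fun j k => (1 - ((e.symm j : ↥(g.range.erase 0)) : ℝ≥0∞)) ^ k.toNat)
    (fun j => measurable_from_top)
  simp_rw [hreindex fun c => (1 - c) ^ _]
  refine (lintegral_prod_eq_prod_lintegral_of_indepFun Finset.univ _ hind' fun j =>
    measurable_from_top.comp (measurable_encard_setOf_mem h.measurable
      (g.measurableSet_fiber _))).trans ?_
  simp only [Function.comp_apply]
  rw [Finset.prod_congr rfl fun j _ => h.lintegral_pow_encard (g.measurableSet_fiber _)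
      (hfin _ (e.symm j).2) tsub_le_self,
    ← hreindex fun c => ENNReal.ofReal (Real.exp (-(lam.toNNReal *
      (volume (g ⁻¹' {c})).toNNReal * (1 - (1 - c).toReal)))),
    ← ENNReal.ofReal_prod_of_nonneg (fun _ _ => (Real.exp_pos _).le), ← Real.exp_sum,
    Finset.sum_neg_distrib]
  congr 3
  rw [SimpleFunc.lintegral_eq_lintegral, SimpleFunc.lintegral,
    ← Finset.sum_erase g.range (a := 0) (by simp), ENNReal.toReal_sum, Finset.mul_sum]
  · refine Finset.sum_congr rfl fun c hc => ?_
    rw [ENNReal.toReal_mul, ENNReal.toReal_sub_of_le (hc1 c hc) ENNReal.one_ne_top,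
      Real.coe_toNNReal _ hlam, ENNReal.coe_toNNReal_eq_toReal, ENNReal.toReal_one]
    ring
  · intro c hc
    exact ENNReal.mul_ne_top ((hc1 c hc).trans_lt ENNReal.one_lt_top).ne (hfin c hc)

/-- The probability generating functional of a homogeneous Poisson point pattern. -/
lemma lintegral_voidProd (h : IsHomogeneousPoisson μ lam X) (hlam : 0 ≤ lam)
    {g : Plane → ℝ≥0∞} (hg : Measurable g)
    (hg1 : ∀ x, g x ≤ 1) {D : Set Plane} (hD : MeasurableSet D) (hD' : volume D ≠ ∞)
    (hgD : ∀ x, x ∉ D → g x = 0) :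
    ∫⁻ ω, voidProd g (fun i => X i ω) ∂μ =
      ENNReal.ofReal (Real.exp (-(lam * (∫⁻ x, g x).toReal))) := by
  let s : ℕ → SimpleFunc Plane ℝ≥0∞ := SimpleFunc.eapprox g
  have hmono : Monotone s := SimpleFunc.monotone_eapprox g
  have hle : ∀ n x, s n x ≤ g x := fun n x => by
    rw [← SimpleFunc.iSup_eapprox_apply hg x]
    exact le_iSup (fun n => (SimpleFunc.eapprox g n) x) n
  have hfin : ∫⁻ x, g x ≠ ∞ := by
    refine ne_top_of_le_ne_top hD' ?_
    calc ∫⁻ x, g x ≤ ∫⁻ x, D.indicator 1 x := lintegral_mono fun x => by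
          by_cases hx : x ∈ D
          · simpa [hx] using hg1 x
          · simp [hx, hgD x hx]
      _ = volume D := lintegral_indicator_one hD
  have hpt : ∀ ω, voidProd g (fun i => X i ω) = ⨅ m, voidProd (s m) (fun i => X i ω) := by
    intro ω
    simp only [voidProd]
    -- With the infima exchanged, the approximation of `g` from below takes place inside a finite
    -- product, where continuity suffices.
    rw [iInf_comm]
    refine iInf_congr fun n => ?_
    have hanti : Antitone fun m => ∏ i ∈ Finset.range n, (1 - s m (X i ω)) := fun a b hab =>
      Finset.prod_le_prod' fun i _ => tsub_le_tsub_left (hmono hab _) 1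
    refine tendsto_nhds_unique ?_ (tendsto_atTop_iInf hanti)
    refine ENNReal.tendsto_finsetProd_of_ne_top _ (fun i _ => ?_) (fun i _ => ?_)
    · exact ENNReal.Tendsto.sub tendsto_const_nhds (SimpleFunc.tendsto_eapprox hg _)
        (Or.inl ENNReal.one_ne_top)
    · exact (tsub_le_self.trans_lt ENNReal.one_lt_top).ne
  simp_rw [hpt]
  have hanti : Antitone fun m ω => voidProd (s m) (fun i => X i ω) := fun a b hab ω =>
    iInf_mono fun n => Finset.prod_le_prod' fun i _ => tsub_le_tsub_left (hmono hab _) 1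
  rw [lintegral_iInf (fun m => measurable_voidProd h.measurable (s m).measurable) hanti]
  · have hs : ∀ m, ∫⁻ ω, voidProd (s m) (fun i => X i ω) ∂μ =
        ENNReal.ofReal (Real.exp (-(lam * (∫⁻ x, s m x).toReal))) := fun m =>
      h.lintegral_voidProd_simpleFunc hlam (s m) (fun x => (hle m x).trans (hg1 x)) hD hD'
        fun x hx => le_antisymm ((hle m x).trans (hgD x hx).le) zero_le
    refine tendsto_nhds_unique (tendsto_atTop_iInf fun a b hab =>
      lintegral_mono (hanti hab)) ?_
    simp_rw [hs]
    refine ENNReal.tendsto_ofReal (Real.continuous_exp.continuousAt.tendsto.comp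
      (Filter.Tendsto.neg (Filter.Tendsto.const_mul _ ?_)))
    refine (ENNReal.tendsto_toReal hfin).comp ?_
    exact lintegral_tendsto_of_tendsto_of_monotone (fun m => (s m).measurable.aemeasurable)
      (Filter.Eventually.of_forall fun x a b hab => hmono hab x)
      (Filter.Eventually.of_forall fun x => SimpleFunc.tendsto_eapprox hg x)
  · refine ne_top_of_le_ne_top (measure_ne_top μ univ) ?_
    rw [← lintegral_one]
    exact lintegral_mono fun ω => iInf_le_of_le 0 (by simp)

end IsHomogeneousPoisson

/-! ### Deterministic properties of the path loss model. -/

namespace PathLossModel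

variable {M : PathLossModel}

lemma measurableSet_piece (n : ℕ) : MeasurableSet (M.piece n) := by
  refine MeasurableSet.inter (s₁ := {w | if n = 1 then M.L ≤ w else M.d (n - 1) < w}) ?_ ?_
  · by_cases h : n = 1
    · simp only [h, if_true]
      exact measurableSet_Ici
    · simp only [h, if_false]
      exact measurableSet_Ioi
  · exact (MeasurableSet.const _).union measurableSet_Iic

lemma ordConnected_piece (n : ℕ) : (M.piece n).OrdConnected := by
  refine ⟨fun a ha b hb c hc => ⟨?_, hb.2.imp id hc.2.trans⟩⟩
  have := ha.1
  split_ifs at this ⊢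
  · exact le_trans this hc.1
  · exact lt_of_lt_of_le this hc.1

lemma measurableSet_radialPiece (n : ℕ) : MeasurableSet (M.radialPiece n) := by
  rw [radialPiece]
  split_ifs
  · exact measurableSet_Ioi
  · exact measurableSet_Ioc

lemma pos_of_mem_radialPiece {n : ℕ} {r : ℝ} (hr : r ∈ M.radialPiece n) : 0 < r := by
  rw [radialPiece] at hr
  split_ifs at hr
  · exact (Real.sqrt_nonneg _).trans_lt hr
  · exact (Real.sqrt_nonneg _).trans_lt hr.1

lemma continuous_dist3 : Continuous M.dist3 := by
  unfold dist3
  fun_prop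

lemma dist3_strictMonoOn : StrictMonoOn M.dist3 (Ici 0) := fun a ha b _ hab => by
  refine Real.sqrt_lt_sqrt (by positivity) ?_
  have := pow_lt_pow_left₀ hab ha two_ne_zero
  linarith

lemma le_dist3_self (r : ℝ) : r ≤ M.dist3 r :=
  Real.le_sqrt_of_sq_le (by nlinarith [sq_nonneg M.L])

lemma tendsto_dist3_atTop : Filter.Tendsto M.dist3 Filter.atTop Filter.atTop :=
  Filter.tendsto_atTop_mono le_dist3_self Filter.tendsto_id

lemma L_le_dist3 (r : ℝ) : M.L ≤ M.dist3 r :=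
  Real.le_sqrt_of_sq_le (by nlinarith [sq_nonneg r])

lemma measurable_loss (p : PathKind) : Measurable (M.loss p) := by
  refine Finset.measurable_fun_sum _ fun n _ => Measurable.indicator ?_ (measurableSet_piece n)
  unfold lossPiece
  fun_prop

lemma equalLossRadius_nonneg (p : PathKind) (n : ℕ) (r : ℝ) : 0 ≤ M.equalLossRadius p n r := by
  rw [equalLossRadius]
  split_ifs with h
  · exact h.choose_spec.1
  · exact le_rfl

namespace Valid

variable (hM : M.Valid)

include hM

lemma d_strictMonoOn : StrictMonoOn M.d (Iio M.N) :=
  strictMonoOn_of_lt_add_one ordConnected_Iio fun n _ _ hn => hM.d_lt n hn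

lemma L_le_d {n : ℕ} (hn : n < M.N) : M.L ≤ M.d n := by
  rw [← hM.d_zero]
  exact hM.d_strictMonoOn.monotoneOn (mem_Iio.2 (by omega)) hn (Nat.zero_le n)

lemma L_le_of_mem_piece {n : ℕ} (hn : n ∈ Finset.Icc 1 M.N) {w : ℝ} (hw : w ∈ M.piece n) :
    M.L ≤ w := by
  have h := hw.1
  rw [Finset.mem_Icc] at hn
  split_ifs at h
  · exact h
  · exact (hM.L_le_d (by omega)).trans h.le

lemma eq_of_mem_piece {m n : ℕ} (hm : m ∈ Finset.Icc 1 M.N) (hn : n ∈ Finset.Icc 1 M.N) {w : ℝ}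
    (hwm : w ∈ M.piece m) (hwn : w ∈ M.piece n) : m = n := by
  have key : ∀ {m n : ℕ}, m ∈ Finset.Icc 1 M.N → n ∈ Finset.Icc 1 M.N → w ∈ M.piece m →
      w ∈ M.piece n → ¬ m < n := by
    intro m n hm hn hwm hwn h
    rw [Finset.mem_Icc] at hm hn
    have h1 := hwn.1
    rw [if_neg (by omega)] at h1
    have h2 := hwm.2.resolve_left (by omega)
    have := hM.d_strictMonoOn.monotoneOn (a := m) (b := n - 1) (mem_Iio.2 (by omega))
      (mem_Iio.2 (by omega)) (by omega)
    linarith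
  have h1 := key hm hn hwm hwn
  have h2 := key hn hm hwn hwm
  omega

lemma exists_mem_piece {w : ℝ} (hw : M.L ≤ w) : ∃ n ∈ Finset.Icc 1 M.N, w ∈ M.piece n := by
  classical
  have hex : ∃ n, 1 ≤ n ∧ (n = M.N ∨ w ≤ M.d n) := ⟨M.N, hM.one_le_N, Or.inl rfl⟩
  have hspec := Nat.find_spec hex
  have hle : Nat.find hex ≤ M.N := Nat.find_min' hex ⟨hM.one_le_N, Or.inl rfl⟩
  refine ⟨Nat.find hex, Finset.mem_Icc.2 ⟨hspec.1, hle⟩, ?_, hspec.2⟩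
  split_ifs with h1
  · exact hw
  · have := Nat.find_min hex (m := Nat.find hex - 1) (by omega)
    have h2 : ¬ w ≤ M.d (Nat.find hex - 1) := fun h => this ⟨by omega, Or.inr h⟩
    exact not_le.1 h2

lemma sum_indicator_piece {n : ℕ} (hn : n ∈ Finset.Icc 1 M.N) {w : ℝ} (hw : w ∈ M.piece n)
    (f : ℕ → ℝ → ℝ) : ∑ m ∈ Finset.Icc 1 M.N, (M.piece m).indicator (f m) w = f n w := by
  rw [Finset.sum_eq_single_of_mem n hn, indicator_of_mem hw]
  intro m hm hmn
  exact indicator_of_notMem (fun h => hmn (hM.eq_of_mem_piece hm hn h hw)) _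

lemma loss_eq {n : ℕ} (hn : n ∈ Finset.Icc 1 M.N) {w : ℝ} (hw : w ∈ M.piece n) (p : PathKind) :
    M.loss p w = M.lossPiece p n w := hM.sum_indicator_piece hn hw _

lemma prob_eq {n : ℕ} (hn : n ∈ Finset.Icc 1 M.N) {w : ℝ} (hw : w ∈ M.piece n) (p : PathKind) :
    M.prob p w = M.probPiece p n w := hM.sum_indicator_piece hn hw _

lemma dist3_mem_piece {n : ℕ} (hn : n ∈ Finset.Icc 1 M.N) {r : ℝ} (hr : r ∈ M.radialPiece n) :
    M.dist3 r ∈ M.piece n := by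
  have hr0 := pos_of_mem_radialPiece hr
  rw [Finset.mem_Icc] at hn
  have hlow : √(M.d (n - 1) ^ 2 - M.L ^ 2) < r := by
    rw [radialPiece] at hr
    split_ifs at hr
    · exact hr
    · exact hr.1
  constructor
  · split_ifs
    · exact L_le_dist3 r
    · refine Real.lt_sqrt_of_sq_lt ?_
      have := (Real.sqrt_lt' hr0).1 hlow
      linarith
  · rw [radialPiece] at hr
    split_ifs at hr with h
    · exact Or.inl h
    · right
      have hL := hM.L_le_d (n := n) (by omega)
      have h0 := hM.L_nonneg
      have := (Real.le_sqrt' hr0).1 hr.2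
      exact Real.sqrt_le_iff.2 ⟨by linarith, by linarith⟩

lemma exists_mem_radialPiece {r : ℝ} (hr : 0 < r) : ∃ n ∈ Finset.Icc 1 M.N, r ∈ M.radialPiece n := by
  have hlt : M.L < M.dist3 r := by
    refine Real.lt_sqrt_of_sq_lt ?_
    have := sq_pos_of_pos hr
    linarith
  obtain ⟨n, hn, hw⟩ := hM.exists_mem_piece hlt.le
  refine ⟨n, hn, ?_⟩
  have hn' := Finset.mem_Icc.1 hn
  have hlow : √(M.d (n - 1) ^ 2 - M.L ^ 2) < r := by
    have h1 : M.d (n - 1) < M.dist3 r := by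
      have := hw.1
      split_ifs at this with h
      · simpa [h, hM.d_zero] using hlt
      · exact this
    rw [Real.sqrt_lt' hr]
    have := (Real.lt_sqrt ((hM.L_nonneg).trans (hM.L_le_d (n := n - 1) (by omega)))).1 h1
    linarith
  rw [radialPiece]
  split_ifs with h
  · exact hlow
  · refine ⟨hlow, (Real.le_sqrt' hr).2 ?_⟩
    have h2 := hw.2.resolve_left h
    have := (Real.sqrt_le_iff.1 h2).2
    linarith

lemma eq_of_mem_radialPiece {m n : ℕ} (hm : m ∈ Finset.Icc 1 M.N) (hn : n ∈ Finset.Icc 1 M.N)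
    {r : ℝ} (hrm : r ∈ M.radialPiece m) (hrn : r ∈ M.radialPiece n) : m = n :=
  hM.eq_of_mem_piece hm hn (hM.dist3_mem_piece hm hrm) (hM.dist3_mem_piece hn hrn)

lemma prob_nonneg (p : PathKind) (w : ℝ) : 0 ≤ M.prob p w := by
  refine Finset.sum_nonneg fun n hn => indicator_nonneg (fun w hw => ?_) w
  have := hM.prL_mem n hn w hw
  cases p
  · exact this.1
  · exact sub_nonneg.2 this.2

lemma prob_add_prob {w : ℝ} (hw : M.L ≤ w) : M.prob .los w + M.prob .nlos w = 1 := by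
  obtain ⟨n, hn, hwn⟩ := hM.exists_mem_piece hw
  rw [hM.prob_eq hn hwn, hM.prob_eq hn hwn]
  simp [probPiece]

lemma prob_le_one (p : PathKind) {w : ℝ} (hw : M.L ≤ w) : M.prob p w ≤ 1 := by
  have h := hM.prob_add_prob hw
  have h1 := hM.prob_nonneg .los w
  have h2 := hM.prob_nonneg .nlos w
  cases p <;> linarith

lemma measurable_prob (p : PathKind) : Measurable (M.prob p) := by
  refine Finset.measurable_fun_sum _ fun n hn => ?_
  have h1 : Measurable ((M.piece n).indicator (M.prL n)) := by
    refine measurable_of_restrict_of_restrict_compl (measurableSet_piece (M := M) n) ?_ ?_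
    · have hanti : Antitone ((M.piece n).domRestrict (M.prL n)) := fun a b hab =>
        hM.prL_antitoneOn n hn a.2 b.2 hab
      have := ordConnected_piece (M := M) n
      convert hanti.measurable using 1
      ext x
      exact indicator_of_mem x.2 _
    · convert measurable_const (a := (0 : ℝ)) using 1
      ext x
      exact indicator_of_notMem x.2 _
  cases p
  · exact h1
  · have : (M.piece n).indicator (M.probPiece .nlos n) =
        (M.piece n).indicator 1 - (M.piece n).indicator (M.prL n) := by
      rw [← indicator_sub']
      rfl
    rw [this]
    exact (measurable_one.indicator (measurableSet_piece n)).sub h1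

/-- Positive exponents are not assumed: every piece contains two distinct positive distances, and a
nonnegative power would not decrease between them. -/
lemma α_pos (p : PathKind) {n : ℕ} (hn : n ∈ Finset.Icc 1 M.N) : 0 < M.α p n := by
  have hn' := Finset.mem_Icc.1 hn
  have hL := hM.L_nonneg
  have hLd := hM.L_le_d (n := n - 1) (by omega)
  obtain ⟨a, b, ha0, hab, ha, hb⟩ : ∃ a b, 0 < a ∧ a < b ∧ a ∈ M.piece n ∧ b ∈ M.piece n := by
    have low : ∀ w, M.d (n - 1) < w → if n = 1 then M.L ≤ w else M.d (n - 1) < w := by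
      intro w hw
      split_ifs
      · linarith
      · exact hw
    by_cases h : n = M.N
    · exact ⟨M.d (n - 1) + 1, M.d (n - 1) + 2, by linarith, by linarith,
        ⟨low _ (by linarith), Or.inl h⟩, ⟨low _ (by linarith), Or.inl h⟩⟩
    · have hlt := hM.d_lt (n - 1) (by omega)
      rw [Nat.sub_add_cancel hn'.1] at hlt
      exact ⟨(M.d (n - 1) + M.d n) / 2, M.d n, by linarith, by linarith,
        ⟨low _ (by linarith), Or.inr (by linarith)⟩, ⟨low _ (by linarith), Or.inr le_rfl⟩⟩
  have hlt := hM.loss_strictAntiOn p ⟨hM.L_le_of_mem_piece hn ha, ha0⟩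
    ⟨hM.L_le_of_mem_piece hn hb, ha0.trans hab⟩ hab
  rw [hM.loss_eq hn ha, hM.loss_eq hn hb, lossPiece, lossPiece] at hlt
  have hlt' := lt_of_mul_lt_mul_left hlt (hM.A_pos p n hn).le
  by_contra hα
  exact absurd (Real.rpow_le_rpow ha0.le hab.le (by linarith : 0 ≤ -M.α p n)) (not_le.2 hlt')

lemma loss_pos (p : PathKind) {w : ℝ} (hw : M.L ≤ w) (hw0 : 0 < w) : 0 < M.loss p w := by
  obtain ⟨n, hn, hwn⟩ := hM.exists_mem_piece hw
  rw [hM.loss_eq hn hwn]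
  exact mul_pos (hM.A_pos p n hn) (Real.rpow_pos_of_pos hw0 _)

lemma tendsto_loss_atTop (p : PathKind) : Filter.Tendsto (M.loss p) Filter.atTop (nhds 0) := by
  have hN : M.N ∈ Finset.Icc 1 M.N := Finset.mem_Icc.2 ⟨hM.one_le_N, le_rfl⟩
  have h := ((tendsto_rpow_neg_atTop (hM.α_pos p hN)).const_mul (M.A p M.N))
  rw [mul_zero] at h
  refine h.congr' ?_
  filter_upwards [Filter.eventually_gt_atTop (M.d (M.N - 1))] with w hw
  have hmem : w ∈ M.piece M.N := by
    refine ⟨?_, Or.inl rfl⟩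
    split_ifs
    · exact (hM.L_le_d (n := M.N - 1) (by have := hM.one_le_N; omega)).trans hw.le
    · exact hw
  rw [hM.loss_eq hN hmem, lossPiece]

/-- With `0 ^ (-α) = 0` for reals, the loss function at the singularity has the default value 0
instead of +∞. It must therefore be kept apart from the decreasing range. -/
lemma loss_zero (p : PathKind) (hL : M.L = 0) : M.loss p 0 = 0 := by
  obtain ⟨n, hn, hwn⟩ := hM.exists_mem_piece hL.le
  rw [hM.loss_eq hn hwn, lossPiece, Real.zero_rpow (neg_ne_zero.2 (hM.α_pos p hn).ne'), mul_zero]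

lemma loss_dist3_strictAntiOn (p : PathKind) :
    StrictAntiOn (fun r => M.loss p (M.dist3 r)) (Ioi 0) := fun a ha b hb hab =>
  hM.loss_strictAntiOn p ⟨L_le_dist3 a, lt_of_lt_of_le ha (le_dist3_self a)⟩
    ⟨L_le_dist3 b, lt_of_lt_of_le hb (le_dist3_self b)⟩
    (dist3_strictMonoOn (mem_Ici.2 (le_of_lt ha)) (mem_Ici.2 (le_of_lt hb)) hab)

lemma loss_dist3_pos (p : PathKind) {r : ℝ} (hr : 0 < r) : 0 < M.loss p (M.dist3 r) :=
  hM.loss_pos p (L_le_dist3 r) (hr.trans_le (le_dist3_self r))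

/-- This covers both cases of the radius. If a root exists, strict monotonicity compares u with it.
If none exists, a value at u at or above the level would, by continuity and decay to 0, force a root
beyond u; so every u > 0 loses, in accordance with the default radius 0. -/
lemma loss_other_lt_iff (p : PathKind) {n : ℕ} (hn : n ∈ Finset.Icc 1 M.N) {r u : ℝ}
    (hr : r ∈ M.radialPiece n) (hu : 0 < u) :
    M.loss p.other (M.dist3 u) < M.loss p (M.dist3 r) ↔ M.equalLossRadius p n r < u := by
  have hr0 := pos_of_mem_radialPiece hr
  have hv := hM.loss_dist3_pos p hr0
  rw [equalLossRadius, ← hM.loss_eq hn (hM.dist3_mem_piece hn hr)]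
  split_ifs with h
  · obtain ⟨hρ0, hρ⟩ := h.choose_spec
    set ρ := h.choose
    -- The chosen root is not the singular point w = 0: the default value there is 0, whereas the
    -- level is positive.
    have hpos : 0 < M.dist3 ρ := by
      refine lt_of_le_of_ne (Real.sqrt_nonneg _) fun h0 => ?_
      have hL : M.L = 0 := le_antisymm (h0 ▸ L_le_dist3 ρ) hM.L_nonneg
      rw [← h0, hM.loss_zero _ hL] at hρ
      exact hv.ne hρ
    rw [← hρ, (hM.loss_strictAntiOn p.other).lt_iff_gt
      ⟨L_le_dist3 u, hu.trans_le (le_dist3_self u)⟩ ⟨L_le_dist3 ρ, hpos⟩]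
    exact dist3_strictMonoOn.lt_iff_lt (mem_Ici.2 hρ0) (mem_Ici.2 hu.le)
  · refine iff_of_true ?_ hu
    by_contra hge
    rw [not_lt] at hge
    have htend := (hM.tendsto_loss_atTop p.other).comp (tendsto_dist3_atTop (M := M))
    obtain ⟨b, hb, hub⟩ := ((htend.eventually (gt_mem_nhds hv)).and
      (Filter.eventually_ge_atTop u)).exists
    have hcont : ContinuousOn (fun r => M.loss p.other (M.dist3 r)) (Icc u b) :=
      (hM.loss_continuousOn p.other).comp continuous_dist3.continuousOn fun x hx =>
        ⟨L_le_dist3 x, (hu.trans_le hx.1).trans_le (le_dist3_self x)⟩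
    obtain ⟨x, hx, hxv⟩ := intermediate_value_Icc' hub hcont ⟨le_of_lt hb, hge⟩
    exact h ⟨x, hu.le.trans hx.1, hxv⟩

end Valid

end PathLossModel

/-! ### Void probabilities of the two kinds of BSs. -/

instance : Fintype PathKind where
  elems := ⟨{PathKind.los, PathKind.nlos}, by simp⟩
  complete p := by cases p <;> simp

lemma PathKind.sum_eq {β : Type*} [AddCommMonoid β] (f : PathKind → β) (p : PathKind) :
    ∑ q, f q = f p + f p.other := by
  have : ∑ q, f q = f .los + f .nlos := by
    simp [Finset.sum, Finset.univ, Fintype.elems]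
  cases p
  · exact this
  · rw [this, add_comm]
    rfl

namespace PathLossModel

variable {M : PathLossModel}

lemma Valid.sum_prob (hM : M.Valid) (r : ℝ) : ∑ q, M.prob q (M.dist3 r) = 1 := by
  rw [PathKind.sum_eq _ .los]
  exact hM.prob_add_prob (L_le_dist3 r)

lemma Valid.measurable_prob_dist3 (hM : M.Valid) (p : PathKind) :
    Measurable fun r => M.prob p (M.dist3 r) :=
  (hM.measurable_prob p).comp continuous_dist3.measurable

variable (M) in
/-- The mean number of BSs with a path of kind `p` at a 2D distance less than `s`. -/
noncomputable def meanCount (lam : ℝ) (p : PathKind) (s : ℝ) : ℝ :=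
  ∫ u in (0 : ℝ)..s, M.prob p (M.dist3 u) * (2 * Real.pi * u * lam)

/-- Polar coordinates: the dimension 2 and the area π of the unit disc give the factor 2π, and the
Jacobian gives u. -/
lemma Valid.lintegral_ball_prob (hM : M.Valid) {lam : ℝ} (p : PathKind) {s : ℝ}
    (hs : 0 ≤ s) :
    lam * (∫⁻ x in Metric.ball (0 : Plane) s, ENNReal.ofReal (M.prob p (M.dist3 ‖x‖))).toReal =
      M.meanCount lam p s := by
  have hm : Measurable fun x : Plane => M.prob p (M.dist3 ‖x‖) :=
    (hM.measurable_prob_dist3 p).comp measurable_norm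
  rw [← integral_toReal (hm.ennreal_ofReal.aemeasurable)
    (Filter.Eventually.of_forall fun _ => ENNReal.ofReal_lt_top)]
  simp_rw [ENNReal.toReal_ofReal (hM.prob_nonneg _ _)]
  rw [← integral_indicator measurableSet_ball]
  have h1 : ((Metric.ball (0 : Plane) s).indicator fun x => M.prob p (M.dist3 ‖x‖)) =
      fun x => (Iio s).indicator (fun u => M.prob p (M.dist3 u)) ‖x‖ := by
    ext x
    simp [indicator]
  rw [h1, integral_fun_norm_addHaar volume ((Iio s).indicator fun u => M.prob p (M.dist3 u)),
    meanCount, intervalIntegral.integral_of_le hs,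
    Measure.real, EuclideanSpace.volume_ball_fin_two]
  have h2 : (fun y : ℝ => y ^ (Module.finrank ℝ Plane - 1) •
      (Iio s).indicator (fun u => M.prob p (M.dist3 u)) y) =
      (Iio s).indicator fun u => u * M.prob p (M.dist3 u) := by
    ext y
    by_cases hy : y < s <;> simp [hy, indicator]
  rw [h2, setIntegral_indicator measurableSet_Iio, Ioi_inter_Iio, ← integral_Ioc_eq_integral_Ioo]
  have h3 : (fun u => M.prob p (M.dist3 u) * (2 * Real.pi * u * lam)) =
      fun u => (2 * Real.pi * lam) * (u * M.prob p (M.dist3 u)) := by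
    ext u
    ring
  rw [h3, integral_const_mul]
  simp [Real.pi_pos.le]
  ring

end PathLossModel

namespace Network.IsModel

variable {Ω : Type*} [MeasurableSpace Ω] {μ : Measure Ω}
  {M : PathLossModel} {lam : ℝ} {fading : PathKind → Measure ℝ} [∀ p, IsProbabilityMeasure (fading p)]
  {S : Network Ω}

/-- Sum `marks` over all assignments of kinds to the first n BSs; the gains are left free and
contribute factors 1. Distributivity turns the sum of products into a product of sums, and each sum
is the probability that one BS avoids its forbidden set. -/
lemma measure_forall_lt_notMem (hS : S.IsModel M μ lam fading) (hM : M.Valid)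
    {D : PathKind → Set Plane} (hD : ∀ q, MeasurableSet (D q)) (n : ℕ) :
    μ {ω | ∀ i < n, S.X i ω ∉ D (S.path i ω)} =
      ∫⁻ ω, ∏ i ∈ Finset.range n, (1 - ∑ q, (D q).indicator
        (fun x => ENNReal.ofReal (M.prob q (M.dist3 ‖x‖))) (S.X i ω)) ∂μ := by
  classical
  have hX := hS.poisson.measurable
  set f : PathKind → Plane → ℝ≥0∞ := fun q => (D q)ᶜ.indicator
    (fun x => ENNReal.ofReal (M.prob q (M.dist3 ‖x‖))) with hf
  have hfm : ∀ q, Measurable (f q) := fun q =>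
    (((hM.measurable_prob_dist3 q).comp measurable_norm).ennreal_ofReal).indicator (hD q).compl
  let E : (Fin n → PathKind) → Set Ω := fun p =>
    {ω | ∀ i : Fin n, S.path i ω = p i ∧ S.X i ω ∉ D (p i)}
  have hunion : {ω | ∀ i < n, S.X i ω ∉ D (S.path i ω)} = ⋃ p, E p := by
    ext ω
    simp only [mem_ofPred_eq, mem_iUnion, E]
    constructor
    · exact fun h => ⟨fun i => S.path i ω, fun i => ⟨rfl, h i i.2⟩⟩
    · rintro ⟨p, hp⟩ i hi
      have := hp ⟨i, hi⟩
      rw [this.1]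
      exact this.2
  have hdisj : Pairwise (Function.onFun Disjoint E) := by
    intro p q hpq
    refine Set.disjoint_left.2 fun ω hp hq => hpq (funext fun i => ?_)
    exact (hp i).1.symm.trans (hq i).1
  have hEm : ∀ p, MeasurableSet (E p) := fun p => by
    have : E p = ⋂ i : Fin n, (S.path i ⁻¹' {p i} ∩ S.X i ⁻¹' (D (p i))ᶜ) := by
      ext ω
      simp [E]
    rw [this]
    exact MeasurableSet.iInter fun i => (hS.path_measurable i trivial).inter
      (hX i (hD _).compl)
  have hE : ∀ p, μ (E p) = ∫⁻ ω, ∏ i : Fin n, f (p i) (S.X i ω) ∂μ := by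
    intro p
    -- `marks` expects kinds for all indices; those from n on play no role.
    let p' : ℕ → PathKind := fun k => if h : k < n then p ⟨k, h⟩ else .los
    have hp' : ∀ i : Fin n, p' i = p i := fun i => by simp [p']
    let C : Set (ℕ → Plane) := {x | ∀ i : Fin n, x i ∉ D (p i)}
    have hC : MeasurableSet C := by
      have : C = ⋂ i : Fin n, (fun x : ℕ → Plane => x i) ⁻¹' (D (p i))ᶜ := by
        ext x
        simp [C]
      rw [this]
      exact MeasurableSet.iInter fun i => measurable_pi_apply _ (hD _).compl
    have hmarks := hS.marks C (Finset.range n) p' (fun _ => univ) hC fun _ => MeasurableSet.univ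
    have hset : E p = {ω | (fun i => S.X i ω) ∈ C ∧
        ∀ i ∈ Finset.range n, S.path i ω = p' i ∧ S.gain i ω ∈ univ} := by
      ext ω
      simp only [E, C, mem_ofPred_eq, Finset.mem_range, mem_univ, and_true]
      constructor
      · exact fun h => ⟨fun i => (h i).2, fun i hi => (h ⟨i, hi⟩).1.trans (hp' ⟨i, hi⟩).symm⟩
      · exact fun h i => ⟨(h.2 i i.2).trans (hp' i), h.1 i⟩
    have hCm : MeasurableSet {ω | (fun i => S.X i ω) ∈ C} :=
      (measurable_pi_lambda _ hX) hC
    rw [hset, hmarks, ← lintegral_indicator hCm]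
    refine lintegral_congr fun ω => ?_
    by_cases hω : (fun i => S.X i ω) ∈ C
    · rw [indicator_of_mem (s := {ω | (fun i => S.X i ω) ∈ C}) hω, Finset.prod_range]
      refine Finset.prod_congr rfl fun i _ => ?_
      rw [hp', measure_univ, mul_one]
      simp only [hf]
      rw [indicator_of_mem (show S.X i ω ∈ (D (p i))ᶜ from hω i)]
    · rw [indicator_of_notMem (s := {ω | (fun i => S.X i ω) ∈ C}) hω]
      simp only [C, mem_ofPred_eq, not_forall, not_not] at hω
      obtain ⟨i, hi⟩ := hω
      exact (Finset.prod_eq_zero (Finset.mem_univ i)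
        (indicator_of_notMem (s := (D (p i))ᶜ) (not_not.2 hi) _)).symm
  have hPm : ∀ p : Fin n → PathKind, Measurable fun ω => ∏ i : Fin n, f (p i) (S.X i ω) :=
    fun p => Finset.measurable_fun_prod _ fun i _ => (hfm (p i)).comp (hX i)
  rw [hunion, measure_iUnion hdisj hEm, tsum_fintype]
  simp_rw [hE]
  rw [← lintegral_finsetSum _ fun p _ => hPm p]
  refine lintegral_congr fun ω => ?_
  rw [Finset.prod_range, ← Fintype.piFinset_univ]
  refine (Finset.prod_univ_sum (fun _ : Fin n => Finset.univ)
    fun i q => f q (S.X i ω)).symm.trans ?_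
  refine Finset.prod_congr rfl fun i _ => ?_
  have hsum : ∑ q, f q (S.X i ω) + ∑ q, (D q).indicator
      (fun x => ENNReal.ofReal (M.prob q (M.dist3 ‖x‖))) (S.X i ω) = 1 := by
    rw [← Finset.sum_add_distrib]
    simp_rw [hf, add_comm (((D _)ᶜ).indicator _ _), indicator_self_add_compl_apply]
    rw [← ENNReal.ofReal_sum_of_nonneg fun q _ => hM.prob_nonneg _ _, hM.sum_prob,
      ENNReal.ofReal_one]
  refine ENNReal.eq_sub_of_add_eq ?_ hsum
  exact ne_top_of_le_ne_top ENNReal.one_ne_top (hsum ▸ le_add_self)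

/-- The probability that for each kind of path all its BSs are at distance at least `s`. -/
lemma measure_forall_le_norm [IsProbabilityMeasure μ] (hS : S.IsModel M μ lam fading) (hM : M.Valid) (hlam : 0 ≤ lam)
    {s : PathKind → ℝ} (hs : ∀ q, 0 ≤ s q) :
    μ {ω | ∀ i, s (S.path i ω) ≤ ‖S.X i ω‖} =
      ENNReal.ofReal (Real.exp (-∑ q, M.meanCount lam q (s q))) := by
  let D : PathKind → Set Plane := fun q => Metric.ball 0 (s q)
  have hD : ∀ q, MeasurableSet (D q) := fun q => measurableSet_ball
  have hX := hS.poisson.measurable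
  let f : PathKind → Plane → ℝ≥0∞ := fun q x => ENNReal.ofReal (M.prob q (M.dist3 ‖x‖))
  have hfm : ∀ q, Measurable (f q) := fun q =>
    ((hM.measurable_prob_dist3 q).comp measurable_norm).ennreal_ofReal
  let g : Plane → ℝ≥0∞ := fun x => ∑ q, (D q).indicator (f q) x
  have hgm : Measurable g := Finset.measurable_fun_sum _ fun q _ => (hfm q).indicator (hD q)
  have hg1 : ∀ x, g x ≤ 1 := fun x => by
    calc g x ≤ ∑ q, f q x := Finset.sum_le_sum fun q _ => indicator_le_self _ _ _
      _ = 1 := by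
        rw [← ENNReal.ofReal_sum_of_nonneg fun q _ => hM.prob_nonneg _ _, hM.sum_prob,
          ENNReal.ofReal_one]
  have hset : {ω | ∀ i, s (S.path i ω) ≤ ‖S.X i ω‖} =
      ⋂ n, {ω | ∀ i < n, S.X i ω ∉ D (S.path i ω)} := by
    ext ω
    simp only [D, mem_ofPred_eq, mem_iInter, mem_ball_zero_iff, not_lt]
    exact ⟨fun h n i _ => h i, fun h i => h (i + 1) i (Nat.lt_succ_self i)⟩
  have hpi : ∀ i, MeasurableSet {ω | S.X i ω ∉ D (S.path i ω)} := fun i => by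
    have : {ω | S.X i ω ∉ D (S.path i ω)} =
        ⋃ q, (S.path i ⁻¹' {q} ∩ S.X i ⁻¹' (D q)ᶜ) := by
      ext ω
      simp
    rw [this]
    exact MeasurableSet.iUnion fun q => (hS.path_measurable i trivial).inter
      (hX i (hD _).compl)
  have hm : ∀ n, MeasurableSet {ω | ∀ i < n, S.X i ω ∉ D (S.path i ω)} := fun n => by
    have : {ω | ∀ i < n, S.X i ω ∉ D (S.path i ω)} =
        ⋂ i, ⋂ _ : i < n, {ω | S.X i ω ∉ D (S.path i ω)} := by
      ext ω
      simp
    rw [this]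
    exact MeasurableSet.iInter fun i => MeasurableSet.iInter fun _ => hpi i
  have hanti : Antitone fun n => {ω | ∀ i < n, S.X i ω ∉ D (S.path i ω)} :=
    fun a b hab ω hω i hi => hω i (hi.trans_le hab)
  -- Continuity from above, matched on the other side by monotone convergence of the finite products
  -- to `voidProd g`.
  rw [hset, hanti.measure_iInter (fun n => (hm n).nullMeasurableSet) ⟨0, measure_ne_top _ _⟩]
  simp_rw [hS.measure_forall_lt_notMem hM hD]
  rw [← lintegral_iInf]
  · have hvol : volume (⋃ q, D q) ≠ ∞ := by
      refine (lt_of_le_of_lt (measure_iUnion_fintype_le _ _) ?_).ne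
      exact ENNReal.sum_lt_top.2 fun q _ => measure_ball_lt_top
    have := hS.poisson.lintegral_voidProd hlam hgm hg1 (MeasurableSet.iUnion hD) hvol
      (fun x hx => Finset.sum_eq_zero fun q _ => indicator_of_notMem
        (fun h => hx (mem_iUnion.2 ⟨q, h⟩)) _)
    refine this.trans ?_
    congr 3
    simp only [g]
    rw [lintegral_finsetSum _ fun q _ => (hfm q).indicator (hD q), ENNReal.toReal_sum,
      Finset.mul_sum]
    · refine Finset.sum_congr rfl fun q _ => ?_
      rw [lintegral_indicator (hD q)]
      exact hM.lintegral_ball_prob q (hs q)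
    · intro q _
      rw [lintegral_indicator (hD q)]
      refine (lt_of_le_of_lt (setLIntegral_mono measurable_const fun x _ =>
        ENNReal.ofReal_le_one.2 (hM.prob_le_one q (PathLossModel.L_le_dist3 _))) ?_).ne
      simpa [D] using measure_ball_lt_top (μ := volume) (x := (0 : Plane)) (r := s q)
  · exact fun n => Finset.measurable_fun_prod _ fun i _ =>
      measurable_const.sub (hgm.comp (hX i))
  · intro a b hab ω
    exact Finset.prod_le_prod_of_subset_of_le_one' (Finset.range_mono hab) fun i _ _ => tsub_le_self
  · simp

end Network.IsModel

/-! ### Density of the distance to the nearest BS of a given kind. -/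

lemma Real.exp_neg_sub_exp_neg_le {x y : ℝ} (hx : 0 ≤ x) (hxy : x ≤ y) :
    Real.exp (-x) - Real.exp (-y) ≤ y - x := by
  have h1 : Real.exp (-y) = Real.exp (-x) * Real.exp (-(y - x)) := by
    rw [← Real.exp_add]
    congr 1
    ring
  have h2 := Real.add_one_le_exp (-(y - x))
  have h3 : Real.exp (-x) ≤ 1 := Real.exp_le_one_iff.2 (by linarith)
  have h4 := Real.exp_pos (-x)
  nlinarith

/-- The LoS probability may jump, so the primitive of `g` need not be differentiable everywhere.
Boundedness of `g` makes F Lipschitz, hence absolutely continuous, and its almost everywhere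
derivative -F g suffices for the fundamental theorem. -/
lemma integral_exp_neg_integral_mul {g : ℝ → ℝ} {b : ℝ} (hb : 0 ≤ b) {K : ℝ≥0}
    (hint : IntervalIntegrable g volume 0 b) (h0 : ∀ u ∈ Icc 0 b, 0 ≤ g u)
    (hK : ∀ u ∈ Icc 0 b, g u ≤ K) :
    ∫ u in (0 : ℝ)..b, Real.exp (-∫ v in (0 : ℝ)..u, g v) * g u =
      1 - Real.exp (-∫ v in (0 : ℝ)..b, g v) := by
  set F : ℝ → ℝ := fun u => Real.exp (-∫ v in (0 : ℝ)..u, g v) with hF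
  have hsub : ∀ x ∈ Icc 0 b, ∀ y ∈ Icc 0 b, IntervalIntegrable g volume x y := fun x hx y hy =>
    hint.mono_set ((uIcc_subset_Icc hx hy).trans (uIcc_of_le hb).ge)
  have hmem0 : (0 : ℝ) ∈ Icc 0 b := ⟨le_rfl, hb⟩
  have hstep : ∀ x ∈ Icc 0 b, ∀ y ∈ Icc 0 b, x ≤ y → |F x - F y| ≤ K * (y - x) := by
    intro x hx y hy hxy
    have hΛx : 0 ≤ ∫ v in (0 : ℝ)..x, g v :=
      intervalIntegral.integral_nonneg hx.1 fun u hu => h0 u ⟨hu.1, hu.2.trans hx.2⟩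
    have hadd := intervalIntegral.integral_add_adjacent_intervals (hsub 0 hmem0 x hx)
      (hsub x hx y hy)
    have hxy0 : 0 ≤ ∫ v in x..y, g v :=
      intervalIntegral.integral_nonneg hxy fun u hu => h0 u ⟨hx.1.trans hu.1, hu.2.trans hy.2⟩
    have hxyK : ∫ v in x..y, g v ≤ K * (y - x) := by
      have := intervalIntegral.integral_mono_on hxy (hsub x hx y hy)
        (intervalIntegrable_const (c := (K : ℝ)))
        fun u hu => hK u ⟨hx.1.trans hu.1, hu.2.trans hy.2⟩
      rwa [intervalIntegral.integral_const, smul_eq_mul, mul_comm] at this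
    have hexp := Real.exp_neg_sub_exp_neg_le hΛx (by linarith : _ ≤ ∫ v in (0 : ℝ)..y, g v)
    have hmono : F y ≤ F x := Real.exp_le_exp.2 (by linarith)
    rw [abs_of_nonneg (sub_nonneg.2 hmono)]
    simp only [hF]
    linarith
  have hlip : LipschitzOnWith K F (uIcc 0 b) := by
    rw [uIcc_of_le hb]
    refine LipschitzOnWith.of_dist_le_mul fun x hx y hy => ?_
    rw [Real.dist_eq, Real.dist_eq]
    rcases le_total x y with hxy | hxy
    · rw [abs_sub_comm x y, abs_of_nonneg (sub_nonneg.2 hxy)]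
      exact hstep x hx y hy hxy
    · rw [abs_sub_comm (F x), abs_of_nonneg (sub_nonneg.2 hxy)]
      exact hstep y hy x hx hxy
  have hFTC := hlip.absolutelyContinuousOnInterval.integral_deriv_eq_sub
  have hcongr : ∫ u in (0 : ℝ)..b, deriv F u = ∫ u in (0 : ℝ)..b, -(F u * g u) := by
    refine intervalIntegral.integral_congr_ae ?_
    filter_upwards [hint.ae_hasDerivAt_integral] with u hu hmem
    have h1 : HasDerivAt F _ u := (hu (uIoc_subset_uIcc hmem) 0 (by simp)).neg.exp
    rw [h1.deriv]
    simp only [Pi.neg_apply]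
    simp only [hF]
    ring
  rw [hcongr, intervalIntegral.integral_neg] at hFTC
  have : F 0 = 1 := by simp [hF]
  linarith

namespace PathLossModel

variable {M : PathLossModel}

lemma meanCount_zero (lam : ℝ) (p : PathKind) : M.meanCount lam p 0 = 0 :=
  intervalIntegral.integral_same

namespace Valid

variable (hM : M.Valid) {lam : ℝ} (hlam : 0 ≤ lam)

include hM hlam

lemma intensity_nonneg (p : PathKind) {u : ℝ} (hu : 0 ≤ u) :
    0 ≤ M.prob p (M.dist3 u) * (2 * Real.pi * u * lam) :=
  mul_nonneg (hM.prob_nonneg _ _) (by have := Real.pi_pos; positivity)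

lemma intensity_le (p : PathKind) {u b : ℝ} (hu : u ∈ Icc 0 b) :
    M.prob p (M.dist3 u) * (2 * Real.pi * u * lam) ≤ 2 * Real.pi * b * lam := by
  have hπ := Real.pi_pos
  have h1 := hM.prob_le_one p (L_le_dist3 (M := M) u)
  have hu0 := hu.1
  calc _ ≤ 1 * (2 * Real.pi * u * lam) := mul_le_mul_of_nonneg_right h1 (by positivity)
    _ ≤ 2 * Real.pi * b * lam := by
      rw [one_mul]
      have := hu.2
      gcongr

omit hlam in
lemma measurable_intensity (p : PathKind) :
    Measurable fun u => M.prob p (M.dist3 u) * (2 * Real.pi * u * lam) :=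
  (hM.measurable_prob_dist3 p).mul (by fun_prop)

lemma intervalIntegrable_intensity (p : PathKind) {b : ℝ} (hb : 0 ≤ b) :
    IntervalIntegrable (fun u => M.prob p (M.dist3 u) * (2 * Real.pi * u * lam)) volume 0 b := by
  rw [intervalIntegrable_iff_integrableOn_Ioc_of_le hb]
  refine Measure.integrableOn_of_bounded (M := 2 * Real.pi * b * lam) (by simp)
    (hM.measurable_intensity p).aestronglyMeasurable ?_
  refine (ae_restrict_iff' measurableSet_Ioc).2 (Filter.Eventually.of_forall fun u hu => ?_)
  rw [Real.norm_of_nonneg (hM.intensity_nonneg hlam p hu.1.le)]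
  exact hM.intensity_le hlam p ⟨hu.1.le, hu.2⟩

lemma integral_exp_neg_meanCount (p : PathKind) {b : ℝ} (hb : 0 ≤ b) :
    ∫ u in (0 : ℝ)..b, Real.exp (-M.meanCount lam p u) *
      (M.prob p (M.dist3 u) * (2 * Real.pi * u * lam)) = 1 - Real.exp (-M.meanCount lam p b) := by
  have hπ := Real.pi_pos
  refine integral_exp_neg_integral_mul hb (K := (2 * Real.pi * b * lam).toNNReal)
    (hM.intervalIntegrable_intensity hlam p hb) (fun u hu => hM.intensity_nonneg hlam p hu.1)
    fun u hu => ?_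
  rw [Real.coe_toNNReal _ (by positivity)]
  exact hM.intensity_le hlam p hu

lemma meanCount_nonneg (p : PathKind) {b : ℝ} (hb : 0 ≤ b) : 0 ≤ M.meanCount lam p b :=
  intervalIntegral.integral_nonneg hb fun _ hu => hM.intensity_nonneg hlam p hu.1

lemma continuousOn_meanCount (p : PathKind) : ContinuousOn (M.meanCount lam p) (Ici 0) := by
  intro x hx
  have h := intervalIntegral.continuousOn_primitive_interval'
    (hM.intervalIntegrable_intensity hlam p (b := x + 1) (by have := mem_Ici.1 hx; linarith))
    left_mem_uIcc
  rw [uIcc_of_le (by have := mem_Ici.1 hx; linarith)] at h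
  refine (h x ⟨hx, by linarith⟩).mono_of_mem_nhdsWithin ?_
  exact Filter.mem_of_superset (inter_mem_nhdsWithin _ (Iic_mem_nhds (by linarith : x < x + 1)))
    fun y hy => ⟨hy.1, hy.2⟩

end Valid

variable (M) in
/-- The density on `(0, ∞)` of the distance to the nearest BS with a path of kind `p`. -/
noncomputable def nearestDensity (lam : ℝ) (p : PathKind) (r : ℝ) : ℝ :=
  Real.exp (-M.meanCount lam p r) * (M.prob p (M.dist3 r) * (2 * Real.pi * r * lam))

namespace Valid

variable (hM : M.Valid) {lam : ℝ} (hlam : 0 ≤ lam)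

include hM hlam

lemma nearestDensity_nonneg (p : PathKind) {r : ℝ} (hr : 0 ≤ r) : 0 ≤ M.nearestDensity lam p r :=
  mul_nonneg (Real.exp_pos _).le (hM.intensity_nonneg hlam p hr)

lemma aemeasurable_nearestDensity (p : PathKind) :
    AEMeasurable (M.nearestDensity lam p) (volume.restrict (Ioi 0)) := by
  refine AEMeasurable.mul ?_ (hM.measurable_intensity p).aemeasurable
  refine Real.measurable_exp.comp_aemeasurable (AEMeasurable.neg ?_)
  exact ((hM.continuousOn_meanCount hlam p).mono Ioi_subset_Ici_self).aemeasurable measurableSet_Ioi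

lemma lintegral_nearestDensity (p : PathKind) {b : ℝ} (hb : 0 ≤ b) :
    ∫⁻ r in Ioo 0 b, ENNReal.ofReal (M.nearestDensity lam p r) =
      ENNReal.ofReal (1 - Real.exp (-M.meanCount lam p b)) := by
  rw [← hM.integral_exp_neg_meanCount hlam p hb, intervalIntegral.integral_of_le hb,
    integral_Ioc_eq_integral_Ioo, ofReal_integral_eq_lintegral_ofReal]
  · rfl
  · refine Integrable.of_bound (C := 2 * Real.pi * b * lam)
      ((hM.aemeasurable_nearestDensity hlam p).mono_measure
        (Measure.restrict_mono Ioo_subset_Ioi_self le_rfl)).aestronglyMeasurable ?_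
    refine (ae_restrict_iff' measurableSet_Ioo).2 (Filter.Eventually.of_forall fun u hu => ?_)
    have h1 := hM.intensity_nonneg hlam p hu.1.le
    refine (Real.norm_of_nonneg (hM.nearestDensity_nonneg hlam p hu.1.le)).trans_le ?_
    refine le_trans (mul_le_of_le_one_left h1 ?_) (hM.intensity_le hlam p ⟨hu.1.le, hu.2.le⟩)
    exact Real.exp_le_one_iff.2 (neg_nonpos.2 (hM.meanCount_nonneg hlam p hu.1.le))
  · exact (ae_restrict_iff' measurableSet_Ioo).2 (Filter.Eventually.of_forall fun u hu =>
      hM.nearestDensity_nonneg hlam p hu.1.le)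

end Valid

end PathLossModel

/-! ### Joint law of the nearest distances of the two kinds. -/

lemma ENNReal.isPiSystem_range_Ici_coe :
    IsPiSystem (range fun a : ℝ≥0 => Ici (a : ℝ≥0∞)) := by
  rintro _ ⟨a, rfl⟩ _ ⟨b, rfl⟩ -
  exact ⟨max a b, by simp [Ici_inter_Ici]⟩

/-- Void probabilities are known at finite radii only, while a nearest distance is ⊤ if its kind is
absent. Finite thresholds still generate everything, as {⊤} is the intersection of the tails at the
naturals. -/
lemma ENNReal.measurableSpace_eq_generateFrom_range_Ici_coe :
    ENNReal.measurableSpace =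
      MeasurableSpace.generateFrom (range fun a : ℝ≥0 => Ici (a : ℝ≥0∞)) := by
  refine le_antisymm ?_ (MeasurableSpace.generateFrom_le ?_)
  · rw [BorelSpace.measurable_eq (α := ℝ≥0∞), borel_eq_generateFrom_Ici]
    refine MeasurableSpace.generateFrom_le ?_
    rintro _ ⟨a, rfl⟩
    induction a with
    | top =>
      have : Ici (⊤ : ℝ≥0∞) = ⋂ n : ℕ, Ici ((n : ℝ≥0) : ℝ≥0∞) := by
        ext x
        simp only [mem_Ici, top_le_iff, mem_iInter, ENNReal.coe_natCast]
        refine ⟨fun h n => h ▸ le_top, fun h => ?_⟩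
        by_contra hx
        obtain ⟨n, hn⟩ := ENNReal.exists_nat_gt hx
        exact (h n).not_gt hn
      rw [this]
      exact MeasurableSet.iInter fun n => MeasurableSpace.measurableSet_generateFrom ⟨n, rfl⟩
    | coe a => exact MeasurableSpace.measurableSet_generateFrom ⟨a, rfl⟩
  · rintro _ ⟨a, rfl⟩
    exact measurableSet_Ici

namespace Network

variable {Ω : Type*} (S : Network Ω)

open Classical in
/-- The distance to the nearest BS with a path of kind `p`. -/
noncomputable def nearest (p : PathKind) (ω : Ω) : ℝ≥0∞ :=
  ⨅ i, if S.path i ω = p then ENNReal.ofReal ‖S.X i ω‖ else ⊤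

variable {S}

lemma le_nearest_iff {p : PathKind} {ω : Ω} {a : ℝ≥0∞} :
    a ≤ S.nearest p ω ↔ ∀ i, S.path i ω = p → a ≤ ENNReal.ofReal ‖S.X i ω‖ := by
  rw [nearest, le_iInf_iff]
  refine forall_congr' fun i => ?_
  by_cases h : S.path i ω = p <;> simp [h]

lemma nearest_le {p : PathKind} {ω : Ω} {i : ℕ} (hi : S.path i ω = p) :
    S.nearest p ω ≤ ENNReal.ofReal ‖S.X i ω‖ :=
  le_nearest_iff.1 le_rfl i hi

namespace IsModel

variable [MeasurableSpace Ω] {μ : Measure Ω}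
  {M : PathLossModel} {lam : ℝ} {fading : PathKind → Measure ℝ} [∀ p, IsProbabilityMeasure (fading p)]

omit [∀ p, IsProbabilityMeasure (fading p)] in
lemma measurable_nearest (hS : S.IsModel M μ lam fading) (p : PathKind) :
    Measurable (S.nearest p) := by
  classical
  refine Measurable.iInf fun i => Measurable.ite (p := fun ω => S.path i ω = p)
    (show MeasurableSet (S.path i ⁻¹' {p}) from hS.path_measurable i trivial) ?_ measurable_const
  exact (measurable_norm.comp (hS.poisson.measurable i)).ennreal_ofReal

variable [IsProbabilityMeasure μ]

/-- The void probability with radius `a` for kind `p` and `b` for the other kind; its additive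
exponent yields the product form from which independence follows. -/
lemma measure_le_nearest_inter (hS : S.IsModel M μ lam fading) (hM : M.Valid) (hlam : 0 ≤ lam)
    (p : PathKind) (a b : ℝ≥0) :
    μ ({ω | (a : ℝ≥0∞) ≤ S.nearest p ω} ∩ {ω | (b : ℝ≥0∞) ≤ S.nearest p.other ω}) =
      ENNReal.ofReal (Real.exp (-M.meanCount lam p a)) *
        ENNReal.ofReal (Real.exp (-M.meanCount lam p.other b)) := by
  classical
  have hne : p.other ≠ p := by cases p <;> simp [PathKind.other]
  let s : PathKind → ℝ := fun q => if q = p then a else b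
  have hs : ∀ q, 0 ≤ s q := fun q => by
    simp only [s]
    split_ifs <;> positivity
  have h := hS.measure_forall_le_norm hM hlam hs
  rw [PathKind.sum_eq _ p, neg_add, Real.exp_add, ENNReal.ofReal_mul (Real.exp_pos _).le] at h
  simp only [s, if_true, if_neg hne] at h
  rw [← h]
  congr 1
  ext ω
  simp only [mem_inter_iff, mem_ofPred_eq, le_nearest_iff]
  have hcoe : ∀ (c : ℝ≥0) (i : ℕ), (c : ℝ≥0∞) ≤ ENNReal.ofReal ‖S.X i ω‖ ↔ (c : ℝ) ≤ ‖S.X i ω‖ := by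
    intro c i
    rw [← ENNReal.ofReal_coe_nnreal, ENNReal.ofReal_le_ofReal_iff (norm_nonneg _)]
  simp only [hcoe]
  constructor
  · rintro ⟨h1, h2⟩ i
    split_ifs with hi
    · exact h1 i hi
    · refine h2 i ?_
      revert hi
      generalize S.path i ω = q
      cases p <;> cases q <;> simp [PathKind.other]
  · intro h
    refine ⟨fun i hi => ?_, fun i hi => ?_⟩
    · simpa [hi] using h i
    · simpa [hi, hne] using h i

lemma measure_le_nearest (hS : S.IsModel M μ lam fading) (hM : M.Valid) (hlam : 0 ≤ lam)
    (p : PathKind) (a : ℝ≥0) :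
    μ {ω | (a : ℝ≥0∞) ≤ S.nearest p ω} = ENNReal.ofReal (Real.exp (-M.meanCount lam p a)) := by
  have h := hS.measure_le_nearest_inter hM hlam p a 0
  simpa [PathLossModel.meanCount_zero] using h

/-- The distances to the nearest BSs with the two kinds of path are independent. -/
lemma indepFun_nearest (hS : S.IsModel M μ lam fading) (hM : M.Valid) (hlam : 0 ≤ lam)
    (p : PathKind) : IndepFun (S.nearest p) (S.nearest p.other) μ := by
  refine IndepSets.indep (hS.measurable_nearest p).comap_le (hS.measurable_nearest p.other).comap_le
    (ENNReal.isPiSystem_range_Ici_coe.comap (S.nearest p))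
    (ENNReal.isPiSystem_range_Ici_coe.comap (S.nearest p.other)) ?_ ?_ ?_
  · rw [ENNReal.measurableSpace_eq_generateFrom_range_Ici_coe, MeasurableSpace.comap_generateFrom]
    rfl
  · rw [ENNReal.measurableSpace_eq_generateFrom_range_Ici_coe, MeasurableSpace.comap_generateFrom]
    rfl
  · rw [IndepSets_iff]
    rintro _ _ ⟨_, ⟨a, rfl⟩, rfl⟩ ⟨_, ⟨b, rfl⟩, rfl⟩
    refine (hS.measure_le_nearest_inter hM hlam p a b).trans ?_
    rw [← hS.measure_le_nearest hM hlam p a, ← hS.measure_le_nearest hM hlam p.other b]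
    rfl

/-- The point ⊤ is removed because `toReal` would send it to 0; the remaining mass can be less than
1. Both measures give `Iio x` the mass 1 - exp(-Λ_p(x)), or 0 for x ≤ 0, and half-open intervals are
differences of such sets. -/
lemma map_nearest_toReal (hS : S.IsModel M μ lam fading) (hM : M.Valid) (hlam : 0 ≤ lam)
    (p : PathKind) :
    ((μ.map (S.nearest p)).restrict {⊤}ᶜ).map ENNReal.toReal =
      (volume.restrict (Ioi 0)).withDensity
        fun r => ENNReal.ofReal (M.nearestDensity lam p r) := by
  have hm := hS.measurable_nearest p
  have hIio : ∀ x : ℝ, ((μ.map (S.nearest p)).restrict {⊤}ᶜ).map ENNReal.toReal (Iio x) =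
      (volume.restrict (Ioi 0)).withDensity
        (fun r => ENNReal.ofReal (M.nearestDensity lam p r)) (Iio x) := by
    intro x
    have hset : ENNReal.toReal ⁻¹' (Iio x) ∩ {⊤}ᶜ = Iio (ENNReal.ofReal x) := by
      ext v
      simp only [mem_inter_iff, mem_preimage, mem_Iio, mem_compl_iff, mem_singleton_iff]
      constructor
      · rintro ⟨h1, h2⟩
        exact (ENNReal.lt_ofReal_iff_toReal_lt h2).2 h1
      · intro h
        have h2 := (h.trans ENNReal.ofReal_lt_top).ne
        exact ⟨(ENNReal.lt_ofReal_iff_toReal_lt h2).1 h, h2⟩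
    have hpre : S.nearest p ⁻¹' Iio (ENNReal.ofReal x) =
        {ω | ((x.toNNReal : ℝ≥0) : ℝ≥0∞) ≤ S.nearest p ω}ᶜ := by
      ext ω
      simp [ENNReal.ofReal]
    rw [Measure.map_apply ENNReal.measurable_toReal measurableSet_Iio,
      Measure.restrict_apply (ENNReal.measurable_toReal measurableSet_Iio), hset,
      Measure.map_apply hm measurableSet_Iio, hpre,
      prob_compl_eq_one_sub (measurableSet_le measurable_const hm), hS.measure_le_nearest hM hlam,
      withDensity_apply _ measurableSet_Iio, Measure.restrict_restrict measurableSet_Iio,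
      Iio_inter_Ioi]
    rcases le_total x 0 with hx | hx
    · rw [Real.toNNReal_of_nonpos hx, Ioo_eq_empty (by simpa using hx)]
      simp [PathLossModel.meanCount_zero]
    · rw [hM.lintegral_nearestDensity hlam p hx, Real.coe_toNNReal _ hx,
        ENNReal.ofReal_sub _ (Real.exp_pos _).le, ENNReal.ofReal_one]
  refine Measure.ext_of_Ico _ _ fun a b hab => ?_
  have hfin : ((μ.map (S.nearest p)).restrict {⊤}ᶜ).map ENNReal.toReal (Iio a) ≠ ∞ :=
    measure_ne_top _ _
  have hdiff : Ico a b = Iio b \ Iio a := by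
    ext x
    simp
  rw [hdiff, measure_sdiff (Iio_subset_Iio hab.le) measurableSet_Iio.nullMeasurableSet hfin,
    measure_sdiff (Iio_subset_Iio hab.le) measurableSet_Iio.nullMeasurableSet (hIio a ▸ hfin),
    hIio, hIio]

/-- The joint law of the distances to the nearest BSs with the two kinds of path, evaluated by
integrating over the distance to the nearest BS with a path of kind `p`. -/
lemma measure_nearest_mem (hS : S.IsModel M μ lam fading) (hM : M.Valid) (hlam : 0 ≤ lam)
    (p : PathKind) {K : Set (ℝ × ℝ≥0∞)} (hK : MeasurableSet K) :
    μ {ω | S.nearest p ω ≠ ⊤ ∧ ((S.nearest p ω).toReal, S.nearest p.other ω) ∈ K} =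
      ∫⁻ r in Ioi 0, ENNReal.ofReal (M.nearestDensity lam p r) *
        μ {ω | (r, S.nearest p.other ω) ∈ K} := by
  have hm := hS.measurable_nearest p
  have hm' := hS.measurable_nearest p.other
  have : IsProbabilityMeasure (μ.map (S.nearest p.other)) :=
    Measure.isProbabilityMeasure_map hm'.aemeasurable
  have hT : MeasurableSet {v : ℝ≥0∞ × ℝ≥0∞ | v.1 ≠ ⊤ ∧ (v.1.toReal, v.2) ∈ K} :=
    (measurable_fst (measurableSet_singleton _).compl).inter
      ((ENNReal.measurable_toReal.comp measurable_fst).prodMk measurable_snd hK)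
  have hsec : Measurable fun r : ℝ => μ.map (S.nearest p.other) (Prod.mk r ⁻¹' K) :=
    measurable_measure_prodMk_left hK
  calc μ {ω | S.nearest p ω ≠ ⊤ ∧ ((S.nearest p ω).toReal, S.nearest p.other ω) ∈ K}
      = μ.map (fun ω => (S.nearest p ω, S.nearest p.other ω))
          {v | v.1 ≠ ⊤ ∧ (v.1.toReal, v.2) ∈ K} := (Measure.map_apply (hm.prodMk hm') hT).symm
    _ = ∫⁻ v, μ.map (S.nearest p.other) (Prod.mk v ⁻¹' {v | v.1 ≠ ⊤ ∧ (v.1.toReal, v.2) ∈ K})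
          ∂μ.map (S.nearest p) := by
        rw [(indepFun_iff_map_prod_eq_prod_map_map hm.aemeasurable hm'.aemeasurable).1
          (hS.indepFun_nearest hM hlam p), Measure.prod_apply hT]
    _ = ∫⁻ v in {⊤}ᶜ, μ.map (S.nearest p.other) (Prod.mk v.toReal ⁻¹' K)
          ∂μ.map (S.nearest p) := by
        rw [← lintegral_indicator (measurableSet_singleton _).compl]
        refine lintegral_congr fun v => ?_
        by_cases hv : v = ⊤ <;> simp [hv, preimage]
    _ = ∫⁻ r, μ.map (S.nearest p.other) (Prod.mk r ⁻¹' K)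
          ∂((μ.map (S.nearest p)).restrict {⊤}ᶜ).map ENNReal.toReal :=
        (lintegral_map hsec ENNReal.measurable_toReal).symm
    _ = ∫⁻ r in Ioi 0, ENNReal.ofReal (M.nearestDensity lam p r) *
        μ.map (S.nearest p.other) (Prod.mk r ⁻¹' K) := by
        rw [hS.map_nearest_toReal hM hlam,
          lintegral_withDensity_eq_lintegral_mul₀
            (hM.aemeasurable_nearestDensity hlam p).ennreal_ofReal hsec.aemeasurable]
        rfl
    _ = _ := by
        refine lintegral_congr fun r => ?_
        rw [Measure.map_apply hm' (measurable_prodMk_left hK)]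
        rfl

end IsModel

end Network

/-! ### The serving BS in terms of the nearest distances. -/

instance : DiscreteMeasurableSpace PathKind := ⟨fun _ => trivial⟩

lemma PathKind.eq_or_eq_other (p q : PathKind) : q = p ∨ q = p.other := by
  cases p <;> cases q <;> simp [PathKind.other]

namespace Network

variable {Ω : Type*} {S : Network Ω} {M : PathLossModel}

/-- The BSs are away from the UE and locally finite. -/
def IsRegularAt (S : Network Ω) (ω : Ω) : Prop :=
  (∀ i, S.X i ω ≠ 0) ∧ ∀ k : ℕ, {i | ‖S.X i ω‖ < k}.Finite

namespace IsRegularAt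

variable {ω : Ω} (hω : S.IsRegularAt ω)

include hω

/-- Local finiteness makes the infimum a minimum over finitely many BSs. -/
lemma exists_eq_nearest {p : PathKind} (hp : S.nearest p ω ≠ ⊤) :
    ∃ i, S.path i ω = p ∧ S.nearest p ω = ENNReal.ofReal ‖S.X i ω‖ := by
  obtain ⟨k, hk⟩ := ENNReal.exists_nat_gt hp
  obtain ⟨j, hj, hjk⟩ : ∃ j, S.path j ω = p ∧ ENNReal.ofReal ‖S.X j ω‖ < k := by
    by_contra! h
    exact hk.not_ge (le_nearest_iff.2 h)
  have hlt : ∀ i, ENNReal.ofReal ‖S.X i ω‖ < k ↔ ‖S.X i ω‖ < k := fun i => by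
    rw [ENNReal.ofReal_lt_iff_lt_toReal (norm_nonneg _) (ENNReal.natCast_ne_top k),
      ENNReal.toReal_natCast]
  have hfin : {i | S.path i ω = p ∧ ‖S.X i ω‖ < k}.Finite := (hω.2 k).subset fun i hi => hi.2
  obtain ⟨i, hi, hmin⟩ := Set.exists_min_image _ (fun i => ‖S.X i ω‖) hfin
    ⟨j, hj, (hlt j).1 hjk⟩
  refine ⟨i, hi.1, le_antisymm (nearest_le hi.1) (le_nearest_iff.2 fun m hm => ?_)⟩
  refine ENNReal.ofReal_le_ofReal ?_
  by_cases hmk : ‖S.X m ω‖ < k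
  · exact hmin m ⟨hm, hmk⟩
  · exact hi.2.le.trans (not_lt.1 hmk)

lemma nearest_ne_zero (p : PathKind) : S.nearest p ω ≠ 0 := by
  intro h
  obtain ⟨i, -, hi⟩ := hω.exists_eq_nearest (p := p) (by simp [h])
  rw [h, eq_comm, ENNReal.ofReal_eq_zero] at hi
  exact hω.1 i (norm_le_zero_iff.1 hi)

lemma toReal_nearest_pos {p : PathKind} (hp : S.nearest p ω ≠ ⊤) : 0 < (S.nearest p ω).toReal :=
  ENNReal.toReal_pos (hω.nearest_ne_zero p) hp

lemma beta_le (hM : M.Valid) {p : PathKind} {i : ℕ} (hi : S.path i ω = p) :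
    S.beta M i ω ≤ M.loss p (M.dist3 (S.nearest p ω).toReal) := by
  have hp : S.nearest p ω ≠ ⊤ := ((nearest_le hi).trans_lt ENNReal.ofReal_lt_top).ne
  rw [beta, hi]
  refine (hM.loss_dist3_strictAntiOn p).antitoneOn (hω.toReal_nearest_pos hp)
    (norm_pos_iff.2 (hω.1 i)) ?_
  exact ENNReal.toReal_le_of_le_ofReal (norm_nonneg _) (nearest_le hi)

lemma exists_beta_eq {p : PathKind} (hp : S.nearest p ω ≠ ⊤) :
    ∃ i, S.path i ω = p ∧ S.beta M i ω = M.loss p (M.dist3 (S.nearest p ω).toReal) := by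
  obtain ⟨i, hi, hn⟩ := hω.exists_eq_nearest hp
  refine ⟨i, hi, ?_⟩
  rw [beta, hi, hn, ENNReal.toReal_ofReal (norm_nonneg _)]

/-- Only the nearest BS of each kind can be best. The kind of BS 0 is certainly present, which gives
a candidate to compare with the other kind, if that occurs. -/
lemma exists_forall_beta_le (hM : M.Valid) : ∃ i, ∀ j, S.beta M j ω ≤ S.beta M i ω := by
  have key : ∀ p, S.nearest p ω ≠ ⊤ → (S.nearest p.other ω ≠ ⊤ →
      M.loss p.other (M.dist3 (S.nearest p.other ω).toReal) ≤
        M.loss p (M.dist3 (S.nearest p ω).toReal)) → ∃ i, ∀ j, S.beta M j ω ≤ S.beta M i ω := by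
    intro p hp hpo
    obtain ⟨i, -, hi⟩ := hω.exists_beta_eq (M := M) hp
    refine ⟨i, fun j => ?_⟩
    rw [hi]
    rcases p.eq_or_eq_other (S.path j ω) with hj | hj
    · exact hω.beta_le hM hj
    · exact (hω.beta_le hM hj).trans (hpo ((nearest_le hj).trans_lt ENNReal.ofReal_lt_top).ne)
  have h0 : S.nearest (S.path 0 ω) ω ≠ ⊤ := ((nearest_le rfl).trans_lt ENNReal.ofReal_lt_top).ne
  set p := S.path 0 ω
  by_cases h : S.nearest p.other ω ≠ ⊤ ∧ M.loss p (M.dist3 (S.nearest p ω).toReal) <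
      M.loss p.other (M.dist3 (S.nearest p.other ω).toReal)
  · have hoo : p.other.other = p := by cases p <;> rfl
    refine key p.other h.1 fun _ => ?_
    rw [hoo]
    exact h.2.le
  · exact key p h0 fun hpo => not_lt.1 fun hlt => h ⟨hpo, hlt⟩

lemma beta_le_beta_serving (hM : M.Valid) (j : ℕ) :
    S.beta M j ω ≤ S.beta M (S.serving M ω) ω := by
  classical
  have h := hω.exists_forall_beta_le hM
  rw [serving, dif_pos h]
  convert Nat.find_spec h j

lemma servingDist_pos : 0 < S.servingDist M ω := norm_pos_iff.2 (hω.1 _)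

/-- Necessary conditions for kind `p` to serve; `servingPath_eq` is the converse under a strict
inequality. They differ by ties between the kinds, which `ae_loss_ne` shows to be null. -/
lemma of_servingPath_eq (hM : M.Valid) {p : PathKind} (hp : S.servingPath M ω = p) :
    S.nearest p ω = ENNReal.ofReal (S.servingDist M ω) ∧ (S.nearest p.other ω ≠ ⊤ →
      M.loss p.other (M.dist3 (S.nearest p.other ω).toReal) ≤
        M.loss p (M.dist3 (S.servingDist M ω))) := by
  have hs : S.beta M (S.serving M ω) ω = M.loss p (M.dist3 (S.servingDist M ω)) := by
    rw [beta, ← hp]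
    rfl
  constructor
  · refine le_antisymm (nearest_le hp) (le_nearest_iff.2 fun i hi => ENNReal.ofReal_le_ofReal ?_)
    have hle := hω.beta_le_beta_serving hM i
    rw [hs, beta, hi] at hle
    exact ((hM.loss_dist3_strictAntiOn p).le_iff_ge (norm_pos_iff.2 (hω.1 i))
      hω.servingDist_pos).1 hle
  · intro hpo
    obtain ⟨i, -, hi⟩ := hω.exists_beta_eq (M := M) hpo
    rw [← hi, ← hs]
    exact hω.beta_le_beta_serving hM i

lemma servingPath_eq (hM : M.Valid) {p : PathKind} (hp : S.nearest p ω ≠ ⊤)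
    (hpo : S.nearest p.other ω = ⊤ ∨ M.loss p.other (M.dist3 (S.nearest p.other ω).toReal) <
      M.loss p (M.dist3 (S.nearest p ω).toReal)) : S.servingPath M ω = p := by
  rcases p.eq_or_eq_other (S.servingPath M ω) with h | h
  · exact h
  · exfalso
    have hne : S.nearest p.other ω ≠ ⊤ := ((nearest_le h).trans_lt ENNReal.ofReal_lt_top).ne
    obtain ⟨i, -, hi⟩ := hω.exists_beta_eq (M := M) hp
    have h1 := hω.beta_le_beta_serving hM i
    have h2 := hω.beta_le hM h
    have h3 := hpo.resolve_left hne
    linarith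

end IsRegularAt

namespace IsModel

variable [MeasurableSpace Ω] {μ : Measure Ω} {lam : ℝ} {fading : PathKind → Measure ℝ}

lemma measurable_beta (hS : S.IsModel M μ lam fading) (i : ℕ) : Measurable (S.beta M i) := by
  have h : Measurable fun x : PathKind × ℝ => M.loss x.1 x.2 :=
    measurable_from_prod_countable_right fun p => PathLossModel.measurable_loss p
  exact h.comp ((hS.path_measurable i).prodMk (PathLossModel.continuous_dist3.measurable.comp
    (measurable_norm.comp (hS.poisson.measurable i))))

lemma measurable_serving (hS : S.IsModel M μ lam fading) : Measurable (S.serving M) := by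
  classical
  let A : ℕ → Set Ω := fun k => {ω | ∀ j, S.beta M j ω ≤ S.beta M k ω}
  have hA : ∀ k, MeasurableSet (A k) := fun k => by
    have : A k = ⋂ j, {ω | S.beta M j ω ≤ S.beta M k ω} := by
      ext ω
      simp [A]
    rw [this]
    exact MeasurableSet.iInter fun j => measurableSet_le (hS.measurable_beta j)
      (hS.measurable_beta k)
  refine measurable_to_countable' fun k => ?_
  -- The second set accounts for the default of `serving`: index 0 is also returned where no maximum
  -- exists.
  have : S.serving M ⁻¹' {k} = (A k ∩ ⋂ m, ⋂ _ : m < k, (A m)ᶜ) ∪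
      (if k = 0 then ⋂ m, (A m)ᶜ else ∅) := by
    ext ω
    simp only [mem_preimage, mem_singleton_iff, serving, mem_union]
    by_cases h : ∃ i, ∀ j, S.beta M j ω ≤ S.beta M i ω
    · rw [dif_pos h]
      have h1 : ω ∉ (if k = 0 then ⋂ m, (A m)ᶜ else ∅) := by
        split_ifs
        · simpa [A] using h
        · exact notMem_empty _
      rw [or_iff_left h1]
      refine Iff.trans (b := Nat.find h = k) (by convert Iff.rfl) ?_
      rw [Nat.find_eq_iff]
      simp [A]
    · rw [dif_neg h]
      have h1 : ω ∉ A k ∩ ⋂ m, ⋂ _ : m < k, (A m)ᶜ := fun hω => h ⟨k, hω.1⟩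
      rw [or_iff_right h1]
      split_ifs with hk
      · simp only [hk, mem_iInter, mem_compl_iff, true_iff]
        exact fun m hm => h ⟨m, hm⟩
      · exact iff_of_false (Ne.symm hk) (notMem_empty _)
  rw [this]
  refine ((hA k).inter (MeasurableSet.iInter fun m => MeasurableSet.iInter fun _ =>
    (hA m).compl)).union ?_
  split_ifs
  · exact MeasurableSet.iInter fun m => (hA m).compl
  · exact MeasurableSet.empty

lemma measurable_apply_serving (hS : S.IsModel M μ lam fading) {β : Type*} [MeasurableSpace β]
    {f : ℕ → Ω → β} (hf : ∀ i, Measurable (f i)) : Measurable fun ω => f (S.serving M ω) ω := by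
  have h : Measurable fun x : ℕ × Ω => f x.1 x.2 := measurable_from_prod_countable_right hf
  exact h.comp (hS.measurable_serving.prodMk measurable_id)

lemma measurable_servingPath (hS : S.IsModel M μ lam fading) : Measurable (S.servingPath M) :=
  hS.measurable_apply_serving hS.path_measurable

lemma measurable_servingDist (hS : S.IsModel M μ lam fading) : Measurable (S.servingDist M) :=
  hS.measurable_apply_serving fun i => measurable_norm.comp (hS.poisson.measurable i)

lemma measurable_servingGain (hS : S.IsModel M μ lam fading) : Measurable (S.servingGain M) :=
  hS.measurable_apply_serving hS.gain_measurable

lemma measurable_interference (hS : S.IsModel M μ lam fading) (P : ℝ) :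
    Measurable (S.interference M P) := by
  classical
  refine Measurable.tsum fun i => Measurable.ite (p := fun ω => i = S.serving M ω)
    (measurableSet_eq_fun measurable_const hS.measurable_serving) measurable_const ?_
  exact ((measurable_const.mul (hS.measurable_beta i)).mul (hS.gain_measurable i)).ennreal_ofReal

variable [IsProbabilityMeasure μ]

lemma ae_isRegularAt (hS : S.IsModel M μ lam fading) : ∀ᵐ ω ∂μ, S.IsRegularAt ω := by
  have h : ∀ᵐ ω ∂μ, ∀ k : ℕ, {i | ‖S.X i ω‖ < k}.Finite := by
    refine ae_all_iff.2 fun k => ?_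
    filter_upwards [hS.poisson.ae_finite (B := Metric.ball 0 k) measurableSet_ball
      measure_ball_lt_top.ne] with ω hω
    simpa using hω
  filter_upwards [hS.poisson.ae_ne_zero, h] with ω h1 h2
  exact ⟨h1, h2⟩

variable [∀ p, IsProbabilityMeasure (fading p)]

/-- Away from ⊤ the law has a density, hence no atoms. -/
lemma measure_nearest_eq (hS : S.IsModel M μ lam fading) (hM : M.Valid) (hlam : 0 ≤ lam)
    (p : PathKind) {t : ℝ≥0∞} (ht : t ≠ ⊤) : μ {ω | S.nearest p ω = t} = 0 := by
  have hm := hS.measurable_nearest p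
  have h := congrArg (fun ν => ν {t.toReal}) (hS.map_nearest_toReal hM hlam p)
  have h0 : (volume.restrict (Ioi 0)).withDensity
      (fun r => ENNReal.ofReal (M.nearestDensity lam p r)) {t.toReal} = 0 :=
    withDensity_absolutelyContinuous _ _
      (Measure.absolutelyContinuous_of_le Measure.restrict_le_self (by simp))
  rw [h0, Measure.map_apply ENNReal.measurable_toReal (measurableSet_singleton _),
    Measure.restrict_apply (ENNReal.measurable_toReal (measurableSet_singleton _)),
    Measure.map_apply hm ((ENNReal.measurable_toReal (measurableSet_singleton _)).inter
      (measurableSet_singleton _).compl)] at h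
  refine measure_mono_null (fun ω hω => ?_) h
  have : S.nearest p ω = t := hω
  simp [this, ht]

lemma measure_lt_nearest (hS : S.IsModel M μ lam fading) (hM : M.Valid) (hlam : 0 ≤ lam)
    (p : PathKind) (a : ℝ≥0) :
    μ {ω | (a : ℝ≥0∞) < S.nearest p ω} = ENNReal.ofReal (Real.exp (-M.meanCount lam p a)) := by
  rw [← hS.measure_le_nearest hM hlam p a]
  refine measure_congr ?_
  have h : ∀ᵐ ω ∂μ, S.nearest p ω ≠ a :=
    measure_eq_zero_iff_ae_notMem.1 (hS.measure_nearest_eq hM hlam p ENNReal.coe_ne_top)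
  filter_upwards [h] with ω hω
  exact propext ⟨fun h => le_of_lt h, fun h => lt_of_le_of_ne h (Ne.symm hω)⟩

end IsModel

end Network

/-! ### Law of the serving kind and distance. -/

namespace Network.IsModel

variable {Ω : Type*} [MeasurableSpace Ω] {μ : Measure Ω} [IsProbabilityMeasure μ]
  {M : PathLossModel} {lam : ℝ} {fading : PathKind → Measure ℝ} [∀ p, IsProbabilityMeasure (fading p)]
  {S : Network Ω}

/-- For a fixed distance r of kind `p`, strict monotonicity permits at most one tying distance of
the other kind, and a single finite value has probability 0. Independence allows integration over r.
-/
lemma ae_loss_ne (hS : S.IsModel M μ lam fading) (hM : M.Valid) (hlam : 0 ≤ lam) (p : PathKind) :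
    ∀ᵐ ω ∂μ, S.nearest p ω ≠ ⊤ → S.nearest p.other ω ≠ ⊤ →
      M.loss p.other (M.dist3 (S.nearest p.other ω).toReal) ≠
        M.loss p (M.dist3 (S.nearest p ω).toReal) := by
  have hloss : ∀ q, Measurable fun r => M.loss q (M.dist3 r) := fun q =>
    (PathLossModel.measurable_loss q).comp PathLossModel.continuous_dist3.measurable
  -- Positivity of the second distance is included because the loss is injective only away from the
  -- singular point.
  let T : Set (ℝ × ℝ≥0∞) := {x | x.2 ≠ ⊤ ∧ 0 < x.2.toReal ∧
    M.loss p.other (M.dist3 x.2.toReal) = M.loss p (M.dist3 x.1)}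
  have hsnd : Measurable fun x : ℝ × ℝ≥0∞ => x.2.toReal :=
    ENNReal.measurable_toReal.comp measurable_snd
  have hT : MeasurableSet T := by
    refine (measurable_snd (measurableSet_singleton _).compl).inter
      ((measurableSet_lt measurable_const hsnd).inter ?_)
    exact measurableSet_eq_fun ((hloss p.other).comp hsnd) ((hloss p).comp measurable_fst)
  have hsec : ∀ r, μ {ω | (r, S.nearest p.other ω) ∈ T} = 0 := by
    intro r
    by_cases hr : ∃ v, (r, v) ∈ T
    · obtain ⟨v, hv⟩ := hr
      refine measure_mono_null (fun ω hω => ?_) (hS.measure_nearest_eq hM hlam p.other hv.1)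
      have hω' : (r, S.nearest p.other ω) ∈ T := hω
      exact (ENNReal.toReal_eq_toReal_iff' hω'.1 hv.1).1
        ((hM.loss_dist3_strictAntiOn p.other).injOn hω'.2.1 hv.2.1 (hω'.2.2.trans hv.2.2.symm))
    · push Not at hr
      simp [hr]
  have h := hS.measure_nearest_mem hM hlam p hT
  simp only [hsec, mul_zero, lintegral_zero] at h
  filter_upwards [measure_eq_zero_iff_ae_notMem.1 h, hS.ae_isRegularAt] with ω hω hreg hp hpo heq
  exact hω ⟨hp, hpo, hreg.toReal_nearest_pos hpo, heq⟩

/-- Almost surely the event says that the nearest distance of kind `p` lies in `B` and the other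
kind is absent or strictly worse. For fixed r the latter is a tail event beyond the equal-loss
radius, so integrating over r produces the density. -/
lemma measure_servingPath_servingDist (hS : S.IsModel M μ lam fading) (hM : M.Valid)
    (hlam : 0 ≤ lam) (p : PathKind) {n : ℕ} (hn : n ∈ Finset.Icc 1 M.N) {B : Set ℝ}
    (hB : MeasurableSet B) (hBn : B ⊆ M.radialPiece n) :
    μ {ω | S.servingPath M ω = p ∧ S.servingDist M ω ∈ B} =
      ∫⁻ r in B, ENNReal.ofReal (M.servingDensity lam p n r) := by
  have hloss : ∀ q, Measurable fun r => M.loss q (M.dist3 r) := fun q =>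
    (PathLossModel.measurable_loss q).comp PathLossModel.continuous_dist3.measurable
  let K : Set (ℝ × ℝ≥0∞) := {x | x.1 ∈ B ∧
    (x.2 = ⊤ ∨ M.loss p.other (M.dist3 x.2.toReal) < M.loss p (M.dist3 x.1))}
  have hK : MeasurableSet K := by
    refine (measurable_fst hB).inter ((measurable_snd (measurableSet_singleton _)).union ?_)
    exact measurableSet_lt
      ((hloss p.other).comp (ENNReal.measurable_toReal.comp measurable_snd))
      ((hloss p).comp measurable_fst)
  have hev : μ {ω | S.servingPath M ω = p ∧ S.servingDist M ω ∈ B} =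
      μ {ω | S.nearest p ω ≠ ⊤ ∧ ((S.nearest p ω).toReal, S.nearest p.other ω) ∈ K} := by
    refine measure_congr ?_
    filter_upwards [hS.ae_isRegularAt, hS.ae_loss_ne hM hlam p] with ω hω hne
    refine propext ⟨?_, ?_⟩
    · rintro ⟨hp, hR⟩
      obtain ⟨h1, h2⟩ := hω.of_servingPath_eq hM hp
      have hfin : S.nearest p ω ≠ ⊤ := h1 ▸ ENNReal.ofReal_ne_top
      have hto : (S.nearest p ω).toReal = S.servingDist M ω := by
        rw [h1, ENNReal.toReal_ofReal hω.servingDist_pos.le]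
      refine ⟨hfin, by simpa only [hto] using hR, ?_⟩
      by_cases hpo : S.nearest p.other ω = ⊤
      · exact Or.inl hpo
      · refine Or.inr (lt_of_le_of_ne ?_ (hne hfin hpo))
        simpa only [hto] using h2 hpo
    · rintro ⟨hfin, hR, hwin⟩
      have hp := hω.servingPath_eq hM hfin hwin
      refine ⟨hp, ?_⟩
      have h1 := (hω.of_servingPath_eq hM hp).1
      simp only [h1, ENNReal.toReal_ofReal hω.servingDist_pos.le] at hR
      exact hR
  have hpos : B ∩ Ioi 0 = B :=
    inter_eq_left.2 fun r hr => PathLossModel.pos_of_mem_radialPiece (hBn hr)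
  rw [hev, hS.measure_nearest_mem hM hlam p hK, ← hpos, ← Measure.restrict_restrict hB,
    ← lintegral_indicator hB]
  refine lintegral_congr fun r => ?_
  by_cases hr : r ∈ B
  · have hrn := hBn hr
    have hr0 := PathLossModel.pos_of_mem_radialPiece hrn
    have hρ := PathLossModel.equalLossRadius_nonneg (M := M) p n r
    rw [indicator_of_mem hr]
    have hsec : μ {ω | (r, S.nearest p.other ω) ∈ K} =
        ENNReal.ofReal (Real.exp (-M.meanCount lam p.other (M.equalLossRadius p n r))) := by
      have h := hS.measure_lt_nearest hM hlam p.other (M.equalLossRadius p n r).toNNReal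
      rw [Real.coe_toNNReal _ hρ] at h
      rw [← h]
      refine measure_congr ?_
      filter_upwards [hS.ae_isRegularAt] with ω hω
      refine propext ((and_iff_right hr).trans ?_)
      change (S.nearest p.other ω = ⊤ ∨ _) ↔
        ENNReal.ofReal (M.equalLossRadius p n r) < S.nearest p.other ω
      by_cases hpo : S.nearest p.other ω = ⊤
      · simp [hpo]
      · rw [or_iff_right hpo, hM.loss_other_lt_iff p hn hrn (hω.toReal_nearest_pos hpo),
          ENNReal.ofReal_lt_iff_lt_toReal hρ hpo]
    rw [hsec, ← ENNReal.ofReal_mul (hM.nearestDensity_nonneg hlam p hr0.le),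
      PathLossModel.nearestDensity, hM.prob_eq hn (hM.dist3_mem_piece hn hrn),
      PathLossModel.servingDensity]
    congr 1
    simp only [PathLossModel.meanCount]
    ring
  · rw [indicator_of_notMem hr]
    simp [K, hr]

lemma map_servingDist_restrict (hS : S.IsModel M μ lam fading) (hM : M.Valid)
    (hlam : 0 ≤ lam) (p : PathKind) {n : ℕ} (hn : n ∈ Finset.Icc 1 M.N) :
    ((μ.restrict {ω | S.servingPath M ω = p}).map (S.servingDist M)).restrict (M.radialPiece n) =
      (volume.restrict (M.radialPiece n)).withDensity
        (fun r => ENNReal.ofReal (M.servingDensity lam p n r)) := by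
  have hpiece := PathLossModel.measurableSet_radialPiece (M := M) n
  have hR := hS.measurable_servingDist
  ext B hB
  rw [Measure.restrict_apply hB, Measure.map_apply hR (hB.inter hpiece),
    Measure.restrict_apply (hR (hB.inter hpiece)), withDensity_apply _ hB,
    Measure.restrict_restrict hB,
    ← hS.measure_servingPath_servingDist hM hlam p hn (hB.inter hpiece) inter_subset_right]
  congr 1
  ext ω
  exact and_comm

lemma servingDensity_nonneg (hM : M.Valid) (hlam : 0 ≤ lam) (p : PathKind) {n : ℕ}
    (hn : n ∈ Finset.Icc 1 M.N) {r : ℝ} (hr : r ∈ M.radialPiece n) :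
    0 ≤ M.servingDensity lam p n r := by
  have hr0 := PathLossModel.pos_of_mem_radialPiece hr
  have hπ := Real.pi_pos
  have := hM.prob_nonneg p (M.dist3 r)
  rw [hM.prob_eq hn (hM.dist3_mem_piece hn hr)] at this
  rw [PathLossModel.servingDensity]
  positivity

end Network.IsModel

/-! ### Measurability of the serving density and the coverage formula. -/

namespace PathLossModel.Valid

variable {M : PathLossModel} (hM : M.Valid) {lam : ℝ} (hlam : 0 ≤ lam)

include hM

/-- The radius is defined by choice, so its measurability is obtained from monotonicity: a more
distant server has a lower level, which fewer u beat. -/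
lemma equalLossRadius_monotoneOn (p : PathKind) {n : ℕ} (hn : n ∈ Finset.Icc 1 M.N) :
    MonotoneOn (M.equalLossRadius p n) (M.radialPiece n) := by
  intro a ha b hb hab
  refine le_of_forall_gt_imp_ge_of_dense fun u hu => ?_
  have hu0 : 0 < u := (equalLossRadius_nonneg p n b).trans_lt hu
  have h1 := (hM.loss_other_lt_iff p hn hb hu0).2 hu
  have h2 := (hM.loss_dist3_strictAntiOn p).antitoneOn (pos_of_mem_radialPiece ha)
    (pos_of_mem_radialPiece hb) hab
  exact ((hM.loss_other_lt_iff p hn ha hu0).1 (h1.trans_le h2)).le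

include hlam

lemma meanCount_monotoneOn (p : PathKind) : MonotoneOn (M.meanCount lam p) (Ici 0) := by
  intro a ha b hb hab
  refine intervalIntegral.integral_mono_interval le_rfl ha hab ?_
    (hM.intervalIntegrable_intensity hlam p hb)
  exact (ae_restrict_iff' measurableSet_Ioc).2
    (Filter.Eventually.of_forall fun u hu => hM.intensity_nonneg hlam p hu.1.le)

lemma aemeasurable_servingDensity (p : PathKind) {n : ℕ} (hn : n ∈ Finset.Icc 1 M.N) :
    AEMeasurable (M.servingDensity lam p n) (volume.restrict (M.radialPiece n)) := by
  have hpiece := measurableSet_radialPiece (M := M) n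
  have h1 : AEMeasurable (fun r => M.meanCount lam p.other (M.equalLossRadius p n r))
      (volume.restrict (M.radialPiece n)) :=
    aemeasurable_restrict_of_monotoneOn hpiece
      ((hM.meanCount_monotoneOn hlam p.other).comp (hM.equalLossRadius_monotoneOn p hn)
        fun r _ => equalLossRadius_nonneg p n r)
  have h2 : AEMeasurable (M.nearestDensity lam p) (volume.restrict (M.radialPiece n)) :=
    (hM.aemeasurable_nearestDensity hlam p).mono_measure
      (Measure.restrict_mono (fun r hr => pos_of_mem_radialPiece hr) le_rfl)
  refine ((Real.measurable_exp.comp_aemeasurable h1.neg).mul h2).congr ?_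
  refine (ae_restrict_iff' hpiece).2 (Filter.Eventually.of_forall fun r hr => ?_)
  simp only [Pi.mul_apply, Function.comp_apply, Pi.neg_apply, nearestDensity, servingDensity,
    hM.prob_eq hn (hM.dist3_mem_piece hn hr), meanCount]
  ring

end PathLossModel.Valid

namespace Network.IsModel

variable {Ω : Type*} [MeasurableSpace Ω] {μ : Measure Ω} [IsProbabilityMeasure μ]
  {M : PathLossModel} {lam : ℝ} {fading : PathKind → Measure ℝ}
  {S : Network Ω}

omit [IsProbabilityMeasure μ] in
lemma measurable_sinr (hS : S.IsModel M μ lam fading) (P PN : ℝ) :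
    Measurable (S.sinr M P PN) := by
  have h : Measurable fun ω => S.beta M (S.serving M ω) ω :=
    hS.measurable_apply_serving hS.measurable_beta
  exact (((measurable_const.mul h).mul hS.measurable_servingGain).ennreal_ofReal).div
    ((hS.measurable_interference P).add measurable_const)

variable [∀ p, IsProbabilityMeasure (fading p)]

/-- Disintegrate the joint law of (kind, distance) and (gain, interference) over the first pair,
then insert the law of the distance on the event that kind `p` serves. -/
lemma measureReal_coverage_inter (hS : S.IsModel M μ lam fading) (hM : M.Valid) (hlam : 0 ≤ lam)
    (P PN γ : ℝ) (p : PathKind) {n : ℕ} (hn : n ∈ Finset.Icc 1 M.N) :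
    μ.real {ω | ENNReal.ofReal γ < S.sinr M P PN ω ∧ S.servingPath M ω = p ∧
      S.servingDist M ω ∈ M.radialPiece n} = S.coverageTerm M μ lam P PN γ p n := by
  classical
  have hpiece := PathLossModel.measurableSet_radialPiece (M := M) n
  have hD := hS.measurable_servingDist
  have hT := hS.measurable_servingPath
  have hX : Measurable fun ω => (S.servingPath M ω, S.servingDist M ω) := hT.prodMk hD
  have hY : Measurable fun ω => (S.servingGain M ω, S.interference M P ω) :=
    hS.measurable_servingGain.prodMk (hS.measurable_interference P)
  set κ := condDistrib (fun ω => (S.servingGain M ω, S.interference M P ω))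
    (fun ω => (S.servingPath M ω, S.servingDist M ω)) μ with hκ
  -- The signal strength is a function of the conditioning distance, so the section of F at (p, r)
  -- is precisely the event in `condCoverage`.
  let F : Set ((PathKind × ℝ) × (ℝ × ℝ≥0∞)) := {z | ENNReal.ofReal γ <
    ENNReal.ofReal (P * M.lossPiece p n (M.dist3 z.1.2) * z.2.1) / (z.2.2 + ENNReal.ofReal PN)}
  have hF : MeasurableSet F := by
    have h1 : Measurable fun z : (PathKind × ℝ) × (ℝ × ℝ≥0∞) => M.lossPiece p n (M.dist3 z.1.2) := by
      have h2 : Measurable (M.lossPiece p n) := by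
        unfold PathLossModel.lossPiece
        fun_prop
      exact h2.comp (PathLossModel.continuous_dist3.measurable.comp
        (measurable_snd.comp measurable_fst))
    refine measurableSet_lt measurable_const (Measurable.div ?_ ?_)
    · exact ((measurable_const.mul h1).mul (measurable_fst.comp measurable_snd)).ennreal_ofReal
    · exact (measurable_snd.comp measurable_snd).add measurable_const
  let W : Set (PathKind × ℝ) := {p} ×ˢ M.radialPiece n
  have hW : MeasurableSet W := (measurableSet_singleton p).prod hpiece
  let φ : ℝ → ℝ≥0∞ := fun r => κ (p, r) (Prod.mk (p, r) ⁻¹' F)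
  have hφ : Measurable φ :=
    (Kernel.measurable_kernel_prodMk_left (κ := κ) hF).comp (measurable_const.prodMk measurable_id)
  have hset : {ω | ENNReal.ofReal γ < S.sinr M P PN ω ∧ S.servingPath M ω = p ∧
      S.servingDist M ω ∈ M.radialPiece n} =
      (fun ω => ((S.servingPath M ω, S.servingDist M ω), (S.servingGain M ω, S.interference M P ω)))
        ⁻¹' (F ∩ Prod.fst ⁻¹' W) := by
    ext ω
    simp only [mem_ofPred_eq, mem_preimage, mem_inter_iff, F, W, mem_prod, mem_singleton_iff]
    refine and_congr_left fun h => ?_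
    have hβ : S.beta M (S.serving M ω) ω = M.lossPiece p n (M.dist3 (S.servingDist M ω)) := by
      rw [← hM.loss_eq hn (hM.dist3_mem_piece hn h.2), ← h.1]
      rfl
    rw [sinr, hβ]
  have key : μ {ω | ENNReal.ofReal γ < S.sinr M P PN ω ∧ S.servingPath M ω = p ∧
      S.servingDist M ω ∈ M.radialPiece n} =
      ∫⁻ r in M.radialPiece n, ENNReal.ofReal (M.servingDensity lam p n r) * φ r := by
    calc _ = ((μ.map fun ω => (S.servingPath M ω, S.servingDist M ω)) ⊗ₘ κ)
          (F ∩ Prod.fst ⁻¹' W) := by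
          rw [hset, hκ, compProd_map_condDistrib hY.aemeasurable,
            Measure.map_apply (hX.prodMk hY) (hF.inter (measurable_fst hW))]
      _ = ∫⁻ ω, κ (S.servingPath M ω, S.servingDist M ω)
            (Prod.mk (S.servingPath M ω, S.servingDist M ω) ⁻¹' (F ∩ Prod.fst ⁻¹' W)) ∂μ := by
          rw [Measure.compProd_apply (hF.inter (measurable_fst hW)),
            lintegral_map (Kernel.measurable_kernel_prodMk_left (hF.inter (measurable_fst hW))) hX]
      _ = ∫⁻ ω in {ω | S.servingPath M ω = p},
            (M.radialPiece n).indicator φ (S.servingDist M ω) ∂μ := by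
          have hTp : MeasurableSet {ω | S.servingPath M ω = p} := hT (measurableSet_singleton p)
          rw [← lintegral_indicator hTp]
          refine lintegral_congr fun ω => ?_
          by_cases h1 : S.servingPath M ω = p
          · rw [indicator_of_mem (s := {ω | S.servingPath M ω = p}) h1, h1]
            by_cases h2 : S.servingDist M ω ∈ M.radialPiece n
            · rw [indicator_of_mem h2]
              congr 1
              ext x
              simp [W, h2]
            · rw [indicator_of_notMem h2]
              simp [W, h2, preimage]
          · rw [indicator_of_notMem (s := {ω | S.servingPath M ω = p}) h1]
            simp [W, h1, preimage]
      _ = ∫⁻ r in M.radialPiece n, φ r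
            ∂((μ.restrict {ω | S.servingPath M ω = p}).map (S.servingDist M)) := by
          rw [← lintegral_indicator hpiece, lintegral_map (hφ.indicator hpiece) hD]
      _ = _ := by
          rw [hS.map_servingDist_restrict hM hlam p hn, lintegral_withDensity_eq_lintegral_mul₀
            (hM.aemeasurable_servingDensity hlam p hn).ennreal_ofReal hφ.aemeasurable]
          rfl
  have hφ1 : ∀ r, φ r ≠ ∞ := fun r => measure_ne_top _ _
  have hcond : ∀ r, S.condCoverage M μ P PN γ p n r = (φ r).toReal := fun r => rfl
  rw [Measure.real, key, coverageTerm, integral_eq_lintegral_of_nonneg_ae]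
  · congr 1
    refine setLIntegral_congr_fun hpiece fun r hr => ?_
    rw [hcond, mul_comm, ENNReal.ofReal_mul ENNReal.toReal_nonneg, ENNReal.ofReal_toReal (hφ1 r)]
  · refine (ae_restrict_iff' hpiece).2 (Filter.Eventually.of_forall fun r hr => ?_)
    exact mul_nonneg (hcond r ▸ ENNReal.toReal_nonneg) (servingDensity_nonneg hM hlam p hn hr)
  · exact (hφ.ennreal_toReal.aemeasurable.mul
      (hM.aemeasurable_servingDensity hlam p hn)).aestronglyMeasurable

lemma coverage_eq_sum (hS : S.IsModel M μ lam fading) (hM : M.Valid) (hlam : 0 ≤ lam)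
    (P PN γ : ℝ) : S.coverage M μ P PN γ =
      ∑ n ∈ Finset.Icc 1 M.N, ∑ p, S.coverageTerm M μ lam P PN γ p n := by
  let A : ℕ × PathKind → Set Ω := fun x => {ω | ENNReal.ofReal γ < S.sinr M P PN ω ∧
    S.servingPath M ω = x.2 ∧ S.servingDist M ω ∈ M.radialPiece x.1}
  have hA : ∀ x, MeasurableSet (A x) := fun x =>
    (measurableSet_lt measurable_const (hS.measurable_sinr P PN)).inter
      ((hS.measurable_servingPath (measurableSet_singleton x.2)).inter
        (hS.measurable_servingDist (PathLossModel.measurableSet_radialPiece x.1)))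
  have hdisj : PairwiseDisjoint ↑(Finset.Icc 1 M.N ×ˢ (Finset.univ : Finset PathKind)) A := by
    rintro ⟨m, p⟩ hm ⟨n, q⟩ hn hne
    simp only [Finset.coe_product, mem_prod, Finset.mem_coe] at hm hn
    refine Set.disjoint_left.2 fun ω hp hq => hne (Prod.ext ?_ ?_)
    · exact hM.eq_of_mem_radialPiece hm.1 hn.1 hp.2.2 hq.2.2
    · exact hp.2.1.symm.trans hq.2.1
  have hcover : {ω | ENNReal.ofReal γ < S.sinr M P PN ω} =ᵐ[μ]
      ⋃ x ∈ Finset.Icc 1 M.N ×ˢ (Finset.univ : Finset PathKind), A x := by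
    filter_upwards [hS.ae_isRegularAt] with ω hω
    refine propext ?_
    change ENNReal.ofReal γ < S.sinr M P PN ω ↔
      ω ∈ ⋃ x ∈ Finset.Icc 1 M.N ×ˢ (Finset.univ : Finset PathKind), A x
    simp only [mem_iUnion, exists_prop]
    constructor
    · intro h
      -- The radial pieces omit 0, so they cover the serving distance only because it is almost
      -- surely positive.
      obtain ⟨n, hn, hr⟩ := hM.exists_mem_radialPiece (hω.servingDist_pos (M := M))
      exact ⟨(n, S.servingPath M ω), Finset.mem_product.2 ⟨hn, Finset.mem_univ _⟩, h, rfl, hr⟩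
    · rintro ⟨x, -, hx⟩
      exact hx.1
  rw [coverage, measureReal_congr hcover, measureReal_biUnion_finset hdisj fun x _ => hA x,
    Finset.sum_product]
  exact Finset.sum_congr rfl fun n hn => Finset.sum_congr rfl fun p _ =>
    hS.measureReal_coverage_inter hM hlam P PN γ p hn

end Network.IsModel

theorem theorem1 {Ω : Type*} [MeasurableSpace Ω] (μ : Measure Ω) [IsProbabilityMeasure μ]
    (M : PathLossModel) (hM : M.Valid)
    (lam P PN γ : ℝ) (hlam : 0 < lam) (hP : 0 < P) (hPN : 0 ≤ PN) (hγ : 0 < γ)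
    (fading : PathKind → Measure ℝ) (hfading : ∀ p, IsProbabilityMeasure (fading p))
    (hfading_nonneg : ∀ p, fading p (Set.Iio 0) = 0)
    (S : Network Ω) (hS : S.IsModel M μ lam fading) :
    S.coverage M μ P PN γ =
        ∑ n ∈ Finset.Icc 1 M.N, (S.coverageTerm M μ lam P PN γ PathKind.los n +
          S.coverageTerm M μ lam P PN γ PathKind.nlos n) ∧
      ∀ p : PathKind, ∀ n ∈ Finset.Icc 1 M.N,
        ((μ.restrict {ω | S.servingPath M ω = p}).map (S.servingDist M)).restrict
            (M.radialPiece n) =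
          (volume.restrict (M.radialPiece n)).withDensity
            (fun r => ENNReal.ofReal (M.servingDensity lam p n r)) := by
  refine ⟨?_, fun p n hn => hS.map_servingDist_restrict hM hlam.le p hn⟩
  rw [hS.coverage_eq_sum hM hlam.le]
  exact Finset.sum_congr rfl fun n _ => PathKind.sum_eq _ .los
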